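/- Fix $n\ge 1$. Paulis on a register are tensor products of $1,X,Y,Z$; the Pauli group consists of these up to powers of $i$; Clifford unitaries are the unitaries whose conjugation maps the Pauli group into itself; stabilizer states of several qubits are the images of $|0\cdots0\rangle$ under Clifford unitaries; the single-qubit pure stabilizer states are the normalized eigenvectors of $X$, $Y$ or $Z$. An $n$-to-1 qubit Clifford reduction consists of a number $m\ge 0$ of ancilla qubits and finitely many Kraus operators on the $n+m$ qubits, $$K_i = k_i\,P_{i,N_i}C_{i,N_i}\cdots P_{i,1}C_{i,1},\qquad \sum_i K_i^\dagger K_i\le 1,$$ where $k_i\le 1$ is real, the $C_{i,x}$ are Clifford unitaries, and $P_{i,x}=(1+s_{i,x})/2$ with $s_{i,x}$ plus or minus a tensor product of $1,X,Y,Z$. On an $n$-qubit mixed state $\rho$ for which the denominator below is nonzero it outputs the single-qubit state $$\rho'=\frac{\mathrm{tr}_{\neq 1}\bigl(\sum_i K_i(\rho\otimes|0\rangle\langle 0|^{\otimes m})K_i^\dagger\bigr)}{\mathrm{tr}\bigl(\sum_i K_i(\rho\otimes|0\rangle\langle 0|^{\otimes m})K_i^\dagger\bigr)},$$ where $\mathrm{tr}_{\neq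 1}$ traces out all qubits except the first resource qubit. (Such operators describe every protocol that uses Clifford unitaries, stabilizer ancillas, Pauli measurements with postselection, feedforward and classical randomness.) An $n$-to-1 stabilizer reduction consists of a stabilizer code on $n$ qubits with $n-1$ independent commuting generators $g_1,\dots,g_{n-1}$ in the Pauli group, generating a group $\mathcal S$ with $-1\notin\mathcal S$, and of a decoding $C$, that is, a Clifford unitary with $C|+_L\rangle=|+\rangle|\phi\rangle$ and $C|-_L\rangle=|-\rangle|\phi\rangle$. Here $|\phi\rangle$ is some stabilizer state of qubits $2,\dots,n$, and $|\pm_L\rangle$ are unit vectors fixed by $\mathcal S$ with $X_L|\pm_L\rangle=\pm|\pm_L\rangle$, for some $X_L\notin\mathcal S$ in the Pauli group commuting with $\mathcal S$. With $P=\prod_j(1+g_j)/2$, it outputs, on a state $\rho$ with $\mathrm{tr}(CP\rho PC^\dagger)\neq 0$, $$\rho''=\frac{\mathrm{tr}_{\neq1}(CP\rho PC^\dagger)}{\mathrm{tr}(CP\rho PC^\dagger)}.$$ Theorem. For every $n$-to-1 qubit Clifford reduction, every $n$-qubit mixed state $\rho$ on which it succeeds with nonzero probability, with output $\rho'$, and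 every single-qubit pure state $|\Psi\rangle$, at least one of the following holds: (i) there is a single-qubit pure stabilizer state $|\phi\rangle$ with $\langle\Psi|\rho'|\Psi\rangle\le|\langle\Psi|\phi\rangle|^2$; (ii) there is an $n$-to-1 stabilizer reduction that succeeds on the same $\rho$ with nonzero probability and whose output $\rho''$ satisfies $\langle\Psi|\rho'|\Psi\rangle\le\langle\Psi|\rho''|\Psi\rangle$. -/

import Mathlib

open scoped Matrix ComplexOrder

noncomputable section

namespace CliffordRed

/-! ### Registers of qubits

A register is a finite type `V` of qubit labels.  Its computational basis is `V → Fin 2`, a ket is a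
function `(V → Fin 2) → ℂ`, and an operator is a matrix indexed by the computational basis. -/

/-- Operators on the register with qubits `V`. -/
abbrev Op (V : Type) : Type := Matrix (V → Fin 2) (V → Fin 2) ℂ

/-- Kets on the register with qubits `V`. -/
abbrev Ket (V : Type) : Type := (V → Fin 2) → ℂ

/-- A vector of norm one. -/
def IsUnitKet {d : Type} [Fintype d] (ψ : d → ℂ) : Prop := star ψ ⬝ᵥ ψ = 1

/-- A density matrix: positive semidefinite of trace one. -/
def IsState {d : Type} [Fintype d] (ρ : Matrix d d ℂ) : Prop := ρ.PosSemidef ∧ ρ.trace = 1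

/-- The ket `|0…0⟩`. -/
def zeroKet (V : Type) [Fintype V] [DecidableEq V] : Ket V := Pi.single 0 1

/-- The operator `|0…0⟩⟨0…0|`. -/
def zeroProj (V : Type) [Fintype V] [DecidableEq V] : Op V := Matrix.single 0 0 1

/-- The tensor product of operators on two registers, on the joint register. -/
def opTensor {V W : Type} (A : Op V) (B : Op W) : Op (V ⊕ W) :=
  Matrix.of fun a b => A (a ∘ Sum.inl) (b ∘ Sum.inl) * B (a ∘ Sum.inr) (b ∘ Sum.inr)

/-- The ket `|α⟩|χ⟩` with `|α⟩` on the qubit `q` and `|χ⟩` on all the other qubits. -/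
def ketTensor {V : Type} (q : V) (α : Fin 2 → ℂ) (χ : Ket {v : V // v ≠ q}) : Ket V :=
  fun a => α (a q) * χ (fun v => a v)

/-- The partial trace over all qubits except the qubit `q`. -/
def traceExcept {V : Type} [Fintype V] [DecidableEq V] (q : V) (M : Op V) :
    Matrix (Fin 2) (Fin 2) ℂ :=
  Matrix.of fun x y => ∑ c : ({v : V // v ≠ q} → Fin 2),
    M ((Equiv.funSplitAt q (Fin 2)).symm (x, c)) ((Equiv.funSplitAt q (Fin 2)).symm (y, c))

/-- The normalized single-qubit output: reduce an unnormalized final state to the qubit `q` and divide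
by its trace. -/
def reducedState {V : Type} [Fintype V] [DecidableEq V] (q : V) (M : Op V) :
    Matrix (Fin 2) (Fin 2) ℂ :=
  (M.trace)⁻¹ • traceExcept q M

/-- The fidelity `⟨Ψ|ρ|Ψ⟩` (a real number when `ρ` is Hermitian). -/
def fidelity (Ψ : Fin 2 → ℂ) (ρ : Matrix (Fin 2) (Fin 2) ℂ) : ℝ :=
  (star Ψ ⬝ᵥ (ρ *ᵥ Ψ)).re

/-! ### Pauli operators and Clifford unitaries -/

/-- The single-qubit matrices `1, X, Y, Z`. -/
def pauli : Fin 4 → Matrix (Fin 2) (Fin 2) ℂ :=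
  ![1, !![0, 1; 1, 0], !![0, -Complex.I; Complex.I, 0], !![1, 0; 0, -1]]

/-- The tensor product over all qubits `v` of the single-qubit matrices `pauli (p v)`. -/
def pauliString {V : Type} [Fintype V] (p : V → Fin 4) : Op V :=
  Matrix.of fun a b => ∏ v, pauli (p v) (a v) (b v)

/-- Membership in the Pauli group: tensor products of `1, X, Y, Z` up to a power of `i`. -/
def InPauliGroup {V : Type} [Fintype V] (M : Op V) : Prop :=
  ∃ (k : Fin 4) (p : V → Fin 4), M = (Complex.I ^ (k : ℕ)) • pauliString p

/-- A measurable Pauli operator: plus or minus a tensor product of `1, X, Y, Z`. -/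
def IsPauliObservable {V : Type} [Fintype V] (s : Op V) : Prop :=
  ∃ p : V → Fin 4, s = pauliString p ∨ s = -pauliString p

/-- The operator `(1 + s) / 2`, the projector for the outcome `+1` of a Pauli observable `s`. -/
def plusProj {V : Type} [DecidableEq V] [Fintype V] (s : Op V) : Op V := (1 / 2 : ℂ) • (1 + s)

/-- Clifford unitaries: the unitaries whose conjugation maps the Pauli group into itself. -/
def IsClifford {V : Type} [Fintype V] [DecidableEq V] (C : Op V) : Prop :=
  C ∈ Matrix.unitaryGroup (V → Fin 2) ℂ ∧ ∀ M : Op V, InPauliGroup M → InPauliGroup (C * M * Cᴴ)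

/-- Pure stabilizer states of a register: images of `|0…0⟩` under Clifford unitaries. -/
def IsStabilizerKet {V : Type} [Fintype V] [DecidableEq V] (φ : Ket V) : Prop :=
  ∃ C : Op V, IsClifford C ∧ φ = C *ᵥ zeroKet V

/-- Single-qubit pure stabilizer states: the normalized eigenvectors of `X`, `Y` or `Z`. -/
def IsQubitStabilizerKet (φ : Fin 2 → ℂ) : Prop :=
  IsUnitKet φ ∧ ∃ p : Fin 4, p ≠ 0 ∧ ∃ c : ℂ, pauli p *ᵥ φ = c • φ

/-! ### Clifford reductions -/

/-- A Clifford Kraus operator `k P_N C_N ⋯ P_1 C_1` with Clifford unitaries `C_x`, Pauli projectors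
`P_x = (1 + s_x) / 2` and a real number `k ≤ 1`. -/
structure CliffordKraus (V : Type) [Fintype V] [DecidableEq V] where
  k : ℝ
  k_le_one : k ≤ 1
  N : ℕ
  C : Fin N → Op V
  s : Fin N → Op V
  isClifford : ∀ x, IsClifford (C x)
  isPauli : ∀ x, IsPauliObservable (s x)

/-- The operator `k P_N C_N ⋯ P_1 C_1`; the list is reversed since step `0` acts first. -/
def CliffordKraus.op {V : Type} [Fintype V] [DecidableEq V] (K : CliffordKraus V) : Op V :=
  (K.k : ℂ) • ((List.ofFn fun x => plusProj (K.s x) * K.C x).reverse).prod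

/-- An `n`-to-1 qubit Clifford reduction: `m` ancilla qubits prepared in `|0⟩`, and finitely many
branches, each with a Clifford Kraus operator `K_i` on resource and ancillas, such that
`∑ K_i† K_i ≤ 1`. -/
structure CliffordReduction (n : ℕ) where
  m : ℕ
  r : ℕ
  branch : Fin r → CliffordKraus (Fin n ⊕ Fin m)
  subnormalized : (1 - ∑ i, (branch i).opᴴ * (branch i).op).PosSemidef

namespace CliffordReduction

variable {n : ℕ}

/-- The unnormalized final state `∑ K_i (ρ ⊗ |0⟩⟨0|^{⊗ m}) K_i†`. -/
def final (R : CliffordReduction n) (ρ : Op (Fin n)) : Op (Fin n ⊕ Fin R.m) :=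
  ∑ i, (R.branch i).op * opTensor ρ (zeroProj (Fin R.m)) * (R.branch i).opᴴ

/-- The reduction succeeds on `ρ` with nonzero probability. -/
def Succeeds (R : CliffordReduction n) (ρ : Op (Fin n)) : Prop := (R.final ρ).trace ≠ 0

/-- The output: the state of the first resource qubit, conditioned on success. -/
def output [NeZero n] (R : CliffordReduction n) (ρ : Op (Fin n)) : Matrix (Fin 2) (Fin 2) ℂ :=
  reducedState (Sum.inl 0) (R.final ρ)

end CliffordReduction

/-! ### Stabilizer reductions -/

/-- A stabilizer code on the register `V` with `l` generators: commuting, independent elements of the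
Pauli group that generate a group not containing `-1`.  As `-1` is excluded, every generator squares
to `1`, so the submonoid generated is the stabilizer group. -/
structure StabilizerCode (V : Type) [Fintype V] [DecidableEq V] (l : ℕ) where
  gen : Fin l → Op V
  inPauli : ∀ i, InPauliGroup (gen i)
  comm : ∀ i j, Commute (gen i) (gen j)
  neg_one_notMem : (-1 : Op V) ∉ Submonoid.closure (Set.range gen)
  indep : ∀ i, gen i ∉ Submonoid.closure (gen '' {j | j ≠ i})

namespace StabilizerCode

variable {V : Type} [Fintype V] [DecidableEq V] {l : ℕ}

/-- The stabilizer group of the code. -/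
def stabilizer (S : StabilizerCode V l) : Submonoid (Op V) := Submonoid.closure (Set.range S.gen)

/-- The projector onto the codespace: all generators are measured with outcome `+1`. -/
def proj (S : StabilizerCode V l) : Op V := (List.ofFn fun i => plusProj (S.gen i)).prod

/-- `ψ` is a normalized state of the codespace. -/
def IsCodeKet (S : StabilizerCode V l) (ψ : Ket V) : Prop :=
  IsUnitKet ψ ∧ ∀ s ∈ S.stabilizer, s *ᵥ ψ = ψ

/-- `XL` is a logical Pauli operator with encoded basis `plusL`, `minusL`: it is in the Pauli group
and commutes with the stabilizer without belonging to it, and `plusL`, `minusL` are normalized code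
states with `XL plusL = plusL` and `XL minusL = -minusL`. -/
structure IsEncodedBasis (S : StabilizerCode V l) (XL : Op V) (plusL minusL : Ket V) : Prop where
  inPauli : InPauliGroup XL
  comm : ∀ s ∈ S.stabilizer, Commute XL s
  notMem : XL ∉ S.stabilizer
  plus_code : S.IsCodeKet plusL
  minus_code : S.IsCodeKet minusL
  plus_eigen : XL *ᵥ plusL = plusL
  minus_eigen : XL *ᵥ minusL = -minusL

/-- The single-qubit state `|+⟩`. -/
def plusKet : Fin 2 → ℂ := ![((Real.sqrt 2)⁻¹ : ℝ), ((Real.sqrt 2)⁻¹ : ℝ)]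

/-- The single-qubit state `|-⟩`. -/
def minusKet : Fin 2 → ℂ := ![((Real.sqrt 2)⁻¹ : ℝ), -((Real.sqrt 2)⁻¹ : ℝ)]

/-- `C` decodes the logical qubit onto the qubit `q`: it is a Clifford unitary with
`|+_L⟩ ↦ |+⟩|φ⟩` and `|-_L⟩ ↦ |-⟩|φ⟩` for an encoded basis of the code and a stabilizer state `|φ⟩`
of the other qubits. -/
def IsDecoding (S : StabilizerCode V l) (q : V) (C : Op V) : Prop :=
  IsClifford C ∧ ∃ (XL : Op V) (plusL minusL : Ket V) (φ : Ket {v : V // v ≠ q}),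
    S.IsEncodedBasis XL plusL minusL ∧ IsStabilizerKet φ ∧
    C *ᵥ plusL = ketTensor q plusKet φ ∧ C *ᵥ minusL = ketTensor q minusKet φ

end StabilizerCode

/-- An `n`-to-1 qubit stabilizer reduction: a stabilizer code on the `n` resource qubits with `n - 1`
generators, and a decoding of its logical qubit onto the first qubit. -/
structure StabilizerReduction (n : ℕ) [NeZero n] where
  code : StabilizerCode (Fin n) (n - 1)
  decode : Op (Fin n)
  isDecoding : code.IsDecoding 0 decode

namespace StabilizerReduction

variable {n : ℕ} [NeZero n]

/-- The unnormalized final state `C P ρ P C†`. -/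
def final (S : StabilizerReduction n) (ρ : Op (Fin n)) : Op (Fin n) :=
  S.decode * S.code.proj * ρ * S.code.proj * S.decodeᴴ

/-- The syndrome with all outcomes `+1` has nonzero probability on `ρ`. -/
def Succeeds (S : StabilizerReduction n) (ρ : Op (Fin n)) : Prop := (S.final ρ).trace ≠ 0

/-- The output: the state of the first qubit, conditioned on the syndrome with all outcomes `+1`. -/
def output (S : StabilizerReduction n) (ρ : Op (Fin n)) : Matrix (Fin 2) (Fin 2) ℂ :=
  reducedState 0 (S.final ρ)

end StabilizerReduction

end CliffordRed

end

open CliffordRed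

/-!
A Clifford reduction is a sum of maps `ρ ↦ B† ρ B`, one for each branch `i` and each basis state `c`
of the qubits that are traced out, where `B : ℂ² → (ℂ²)^{⊗ n}` is `α ↦ ⟨0…0| K_i† (α ⊗ |c⟩)`, the bra
acting on the ancillas. The output is a mixture of the normalized outputs of these maps, so its
fidelity with `Ψ` is at most that of one of them (`exists_fidelity_le`).

Each `B` is a stabilizer map (`IsStabilizerMap`): either a multiple of `C J`, with `C` a Clifford
unitary and `J α = α ⊗ |0…0⟩`, or a map that factors through the projector `|φ⟩⟨φ|` onto a
single-qubit stabilizer state. To see that a projector `(1 + s) / 2` preserves this form, conjugate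
`s` by `C`, and call the result `s` again. If `s` anticommutes with some `Z_v` that stabilizes the
range of `J`, then `(1 + s) / 2 * J = 2^{-1/2} U J` with the Clifford unitary `U = (s + Z_v) / √2`.
Otherwise `s` acts on the range of `J` as `σ`, plus or minus a Pauli operator of one qubit, and
`(1 + σ) / 2` is `0`, `1` or `|φ⟩⟨φ|` (`IsStabilizerMap.plusProj_mul`).

After projection of the ancillas onto `|0…0⟩`, their operators `Z` stabilize the range of `C J`. The
unitary `C` can then be changed to one that commutes with all these `Z` and agrees with `C` on the
range of `J` (`IsClifford.exists_commute_pauliZ`): such a unitary restricts to a Clifford unitary on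
the resource qubits (`IsClifford.compress`).

If `B` factors through `|φ⟩⟨φ|`, its normalized output is `|φ⟩⟨φ|`. If `B = k C J`, its normalized
output is that of the stabilizer reduction with generators `C Z_v C†` and decoding `C†`
(`IsClifford.reduction`).
-/

noncomputable section

namespace CliffordRed

/-! ### The Pauli group -/

section PauliGroup

variable {V : Type} [Fintype V]

/-- The tensor product over all qubits `v` of the single-qubit operators `A v`. -/
def tensorAll (A : V → Matrix (Fin 2) (Fin 2) ℂ) : Op V :=
  Matrix.of fun a b => ∏ v, A v (a v) (b v)

theorem pauliString_eq (p : V → Fin 4) : pauliString p = tensorAll fun v => pauli (p v) := rfl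

theorem tensorAll_mul [DecidableEq V] (A B : V → Matrix (Fin 2) (Fin 2) ℂ) :
    tensorAll A * tensorAll B = tensorAll fun v => A v * B v := by
  ext a b
  simp only [tensorAll, Matrix.mul_apply, Matrix.of_apply, Finset.prod_univ_sum,
    Fintype.piFinset_univ, Finset.prod_mul_distrib]

theorem tensorAll_one [DecidableEq V] : tensorAll (fun _ : V => 1) = 1 := by
  ext a b
  simp only [tensorAll, Matrix.of_apply, Matrix.one_apply, Finset.prod_ite_zero,
    Finset.prod_const_one, funext_iff, Finset.mem_univ, true_imp_iff]

theorem tensorAll_smul (c : V → ℂ) (A : V → Matrix (Fin 2) (Fin 2) ℂ) :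
    (tensorAll fun v => c v • A v) = (∏ v, c v) • tensorAll A := by
  ext a b
  simp [tensorAll, Finset.prod_mul_distrib]

theorem tensorAll_conjTranspose (A : V → Matrix (Fin 2) (Fin 2) ℂ) :
    (tensorAll A)ᴴ = tensorAll fun v => (A v)ᴴ := by
  ext a b
  simp [tensorAll, Matrix.conjTranspose_apply]

theorem pauli_conjTranspose (i : Fin 4) : (pauli i)ᴴ = pauli i := by
  fin_cases i <;> ext x y <;> fin_cases x <;> fin_cases y <;>
    simp [pauli, Matrix.conjTranspose_apply]

theorem pauli_mul_self (i : Fin 4) : pauli i * pauli i = 1 := by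
  fin_cases i <;> ext x y <;> fin_cases x <;> fin_cases y <;>
    simp [pauli, Matrix.mul_apply, Fin.sum_univ_two]

theorem pauli_mul (i j : Fin 4) :
    ∃ (k : ℕ) (l : Fin 4), pauli i * pauli j = (Complex.I ^ k) • pauli l := by
  -- The multiplication table: exponents `k` of `i`, then indices `l`.
  have h : ∀ i j : Fin 4, pauli i * pauli j =
      (Complex.I ^ ((![![0, 0, 0, 0], ![0, 0, 1, 3], ![0, 3, 0, 1], ![0, 1, 3, 0]] :
        Fin 4 → Fin 4 → ℕ) i j)) • pauli ((![![0, 1, 2, 3], ![1, 0, 3, 2], ![2, 3, 0, 1],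
          ![3, 2, 1, 0]] : Fin 4 → Fin 4 → Fin 4) i j) := by
    intro i j
    fin_cases i <;> fin_cases j <;> ext x y <;> fin_cases x <;> fin_cases y <;>
      simp [pauli, Matrix.mul_apply, Fin.sum_univ_two, Complex.I_pow_three]
  exact ⟨_, _, h i j⟩

theorem pauli_comm_or_anticomm (i j : Fin 4) :
    ∃ c : ℂ, (c = 1 ∨ c = -1) ∧ pauli i * pauli j = c • (pauli j * pauli i) := by
  by_cases h : i = 0 ∨ j = 0 ∨ i = j
  · refine ⟨1, Or.inl rfl, ?_⟩
    rcases h with rfl | rfl | rfl <;> simp [pauli]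
  · refine ⟨-1, Or.inr rfl, ?_⟩
    push Not at h
    fin_cases i <;> fin_cases j <;> simp_all <;> ext x y <;> fin_cases x <;> fin_cases y <;>
      simp [pauli, Matrix.mul_apply, Fin.sum_univ_two]

theorem inPauliGroup_of_pow (k : ℕ) (p : V → Fin 4) :
    InPauliGroup ((Complex.I ^ k) • pauliString p) := by
  refine ⟨⟨k % 4, Nat.mod_lt _ (by norm_num)⟩, p, ?_⟩
  rw [← Complex.I_pow_eq_pow_mod]

theorem inPauliGroup_pauliString (p : V → Fin 4) : InPauliGroup (pauliString p) := by
  simpa using inPauliGroup_of_pow 0 p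

theorem InPauliGroup.smul_I_pow {M : Op V} (h : InPauliGroup M) (k : ℕ) :
    InPauliGroup ((Complex.I ^ k) • M) := by
  obtain ⟨l, p, rfl⟩ := h
  rw [smul_smul, ← pow_add]
  exact inPauliGroup_of_pow _ _

theorem InPauliGroup.neg {M : Op V} (h : InPauliGroup M) : InPauliGroup (-M) := by
  simpa using h.smul_I_pow 2

theorem pauliString_conjTranspose (p : V → Fin 4) : (pauliString p)ᴴ = pauliString p := by
  simp only [pauliString_eq, tensorAll_conjTranspose, pauli_conjTranspose]

theorem IsPauliObservable.inPauliGroup {s : Op V} (hs : IsPauliObservable s) :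
    InPauliGroup s := by
  obtain ⟨p, rfl | rfl⟩ := hs
  · exact inPauliGroup_pauliString p
  · exact (inPauliGroup_pauliString p).neg

theorem one_ne_neg_one_op : (1 : Op V) ≠ -1 := by
  intro h
  have := congrFun (congrFun h 0) 0
  norm_num [Matrix.one_apply] at this

theorem IsPauliObservable.conjTranspose {s : Op V} (hs : IsPauliObservable s) : sᴴ = s := by
  obtain ⟨p, rfl | rfl⟩ := hs <;> simp [pauliString_conjTranspose]

variable [DecidableEq V]

theorem inPauliGroup_one : InPauliGroup (1 : Op V) := by
  have := inPauliGroup_pauliString (fun _ : V => 0)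
  rwa [pauliString_eq, show pauli 0 = 1 from rfl, tensorAll_one] at this

theorem pauliString_mul_self (p : V → Fin 4) : pauliString p * pauliString p = 1 := by
  simp only [pauliString_eq, tensorAll_mul, pauli_mul_self, tensorAll_one]

theorem InPauliGroup.mul {M N : Op V} (hM : InPauliGroup M) (hN : InPauliGroup N) :
    InPauliGroup (M * N) := by
  obtain ⟨k, p, rfl⟩ := hM
  obtain ⟨l, p', rfl⟩ := hN
  choose e f h using fun v => pauli_mul (p v) (p' v)
  have : pauliString p * pauliString p' = (Complex.I ^ (∑ v, e v)) • pauliString f := by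
    simp only [pauliString_eq, tensorAll_mul, h, tensorAll_smul, Finset.prod_pow_eq_pow_sum]
  rw [smul_mul_smul_comm, this]
  simpa only [smul_smul, ← pow_add] using inPauliGroup_of_pow _ _

theorem InPauliGroup.comm_or_anticomm {M N : Op V} (hM : InPauliGroup M) (hN : InPauliGroup N) :
    M * N = N * M ∨ M * N = -(N * M) := by
  obtain ⟨k, p, rfl⟩ := hM
  obtain ⟨l, p', rfl⟩ := hN
  choose c hc h using fun v => pauli_comm_or_anticomm (p v) (p' v)
  have h1 : pauliString p * pauliString p' = (∏ v, c v) • (pauliString p' * pauliString p) := by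
    simp only [pauliString_eq, tensorAll_mul, h, tensorAll_smul]
  have h2 : (∏ v, c v) = 1 ∨ (∏ v, c v) = -1 :=
    Finset.prod_induction c (fun z => z = 1 ∨ z = -1)
      (by rintro _ _ (rfl | rfl) (rfl | rfl) <;> simp) (Or.inl rfl) fun v _ => hc v
  rw [smul_mul_smul_comm, smul_mul_smul_comm, h1, mul_comm (Complex.I ^ (l : ℕ))]
  rcases h2 with h2 | h2 <;> simp [h2]

theorem InPauliGroup.mul_conjTranspose_self {M : Op V} (hM : InPauliGroup M) : M * Mᴴ = 1 := by
  obtain ⟨k, p, rfl⟩ := hM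
  rw [Matrix.conjTranspose_smul, pauliString_conjTranspose, smul_mul_smul_comm,
    pauliString_mul_self, star_pow, ← mul_pow]
  simp

theorem InPauliGroup.mem_unitaryGroup {M : Op V} (hM : InPauliGroup M) :
    M ∈ Matrix.unitaryGroup (V → Fin 2) ℂ :=
  Matrix.mem_unitaryGroup_iff.2 hM.mul_conjTranspose_self

theorem InPauliGroup.mul_self {M : Op V} (hM : InPauliGroup M) : M * M = 1 ∨ M * M = -1 := by
  obtain ⟨k, p, rfl⟩ := hM
  rw [smul_mul_smul_comm, pauliString_mul_self]
  fin_cases k <;> simp [Complex.I_pow_three]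

theorem IsPauliObservable.mul_self {s : Op V} (hs : IsPauliObservable s) : s * s = 1 := by
  obtain ⟨p, rfl | rfl⟩ := hs <;> simp [pauliString_mul_self]

theorem InPauliGroup.isPauliObservable {M : Op V} (hM : InPauliGroup M) (h : M * M = 1) :
    IsPauliObservable M := by
  obtain ⟨k, p, rfl⟩ := hM
  rw [smul_mul_smul_comm, pauliString_mul_self] at h
  have := one_ne_neg_one_op (V := V)
  fin_cases k
  · exact ⟨p, Or.inl (by simp)⟩
  · exact absurd h.symm (by simpa using this)
  · exact ⟨p, Or.inr (by simp)⟩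
  · exact absurd h.symm (by simpa [Complex.I_pow_three] using this)

/-- Of `M` and `i M`, one is Hermitian. -/
theorem InPauliGroup.exists_smul_isPauliObservable {M : Op V} (hM : InPauliGroup M) :
    ∃ k : ℕ, IsPauliObservable ((Complex.I ^ k) • M) := by
  rcases hM.mul_self with h | h
  · exact ⟨0, by simpa using hM.isPauliObservable h⟩
  · refine ⟨1, (hM.smul_I_pow 1).isPauliObservable ?_⟩
    rw [smul_mul_smul_comm, h]
    simp

/-! ### Clifford unitaries -/

namespace IsClifford

variable {C D : Op V}

theorem mul_conjTranspose (hC : IsClifford C) : C * Cᴴ = 1 := Matrix.mem_unitaryGroup_iff.1 hC.1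

theorem conjTranspose_mul (hC : IsClifford C) : Cᴴ * C = 1 := Matrix.mem_unitaryGroup_iff'.1 hC.1

theorem mul (hC : IsClifford C) (hD : IsClifford D) : IsClifford (C * D) := by
  refine ⟨mul_mem hC.1 hD.1, fun M hM => ?_⟩
  have := hC.2 _ (hD.2 M hM)
  simpa only [Matrix.conjTranspose_mul, mul_assoc] using this

/-- Conjugation by a Clifford unitary is an injective self-map of the finite Pauli group, hence
surjective. -/
theorem conjTranspose (hC : IsClifford C) : IsClifford Cᴴ := by
  refine ⟨Matrix.mem_unitaryGroup_iff.2 (by simpa [Matrix.star_eq_conjTranspose] using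
    hC.conjTranspose_mul), fun M hM => ?_⟩
  have hfin : {M : Op V | InPauliGroup M}.Finite := by
    refine (Set.finite_range fun x : Fin 4 × (V → Fin 4) =>
      (Complex.I ^ (x.1 : ℕ)) • pauliString x.2).subset ?_
    rintro _ ⟨k, p, rfl⟩
    exact ⟨(k, p), rfl⟩
  have hinj : Set.InjOn (fun M : Op V => C * M * Cᴴ) {M : Op V | InPauliGroup M} := by
    intro M _ N _ h
    have := congrArg (fun T => Cᴴ * T * C) h
    simpa only [mul_assoc, hC.conjTranspose_mul, mul_one,
      ← mul_assoc Cᴴ C, one_mul] using this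
  obtain ⟨N, hN, rfl⟩ := ((hfin.injOn_iff_bijOn_of_mapsTo hC.2).1 hinj).surjOn hM
  have hN' : Cᴴ * (C * N * Cᴴ) * Cᴴᴴ = N := by
    rw [Matrix.conjTranspose_conjTranspose]
    simp only [mul_assoc, hC.conjTranspose_mul, mul_one, ← mul_assoc Cᴴ C, one_mul]
  rw [hN']
  exact hN

theorem conj_mul_conj (hC : IsClifford C) (M N : Op V) :
    (C * M * Cᴴ) * (C * N * Cᴴ) = C * (M * N) * Cᴴ := by
  simp only [mul_assoc, ← mul_assoc Cᴴ C, hC.conjTranspose_mul, one_mul]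

theorem isPauliObservable_conj (hC : IsClifford C) {s : Op V} (hs : IsPauliObservable s) :
    IsPauliObservable (C * s * Cᴴ) := by
  refine (hC.2 s hs.inPauliGroup).isPauliObservable ?_
  rw [hC.conj_mul_conj, hs.mul_self, mul_one, hC.mul_conjTranspose]

end IsClifford

theorem InPauliGroup.isClifford {M : Op V} (hM : InPauliGroup M) : IsClifford M := by
  refine ⟨hM.mem_unitaryGroup, fun N hN => ?_⟩
  rcases hM.comm_or_anticomm hN with h | h
  · rw [h, mul_assoc, hM.mul_conjTranspose_self, mul_one]
    exact hN
  · rw [h, neg_mul, mul_assoc, hM.mul_conjTranspose_self, mul_one]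
    exact hN.neg

theorem isClifford_one : IsClifford (1 : Op V) := inPauliGroup_one.isClifford

/-- The operator `(s + g) / √2`. For anticommuting observables `s` and `g` it is a Clifford unitary
that exchanges them under conjugation. -/
def swapUnitary (s g : Op V) : Op V := (((Real.sqrt 2)⁻¹ : ℝ) : ℂ) • (s + g)

theorem inv_sqrt_two_mul_self :
    (((Real.sqrt 2)⁻¹ : ℝ) : ℂ) * (((Real.sqrt 2)⁻¹ : ℝ) : ℂ) = 1 / 2 := by
  rw [← Complex.ofReal_mul, ← mul_inv, Real.mul_self_sqrt (by norm_num)]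
  norm_num

theorem swapUnitary_conj {s g : Op V} (hs : IsPauliObservable s) (hg : IsPauliObservable g)
    (M : Op V) :
    swapUnitary s g * M * (swapUnitary s g)ᴴ = (1 / 2 : ℂ) • ((s + g) * M * (s + g)) := by
  rw [swapUnitary, Matrix.conjTranspose_smul, Matrix.conjTranspose_add, hs.conjTranspose,
    hg.conjTranspose, smul_mul_assoc, smul_mul_smul_comm]
  rw [show star ((((Real.sqrt 2)⁻¹ : ℝ) : ℂ)) = (((Real.sqrt 2)⁻¹ : ℝ) : ℂ) from
    Complex.conj_ofReal _, inv_sqrt_two_mul_self]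

theorem isClifford_swapUnitary {s g : Op V} (hs : IsPauliObservable s)
    (hg : IsPauliObservable g) (h : s * g = -(g * s)) : IsClifford (swapUnitary s g) := by
  have hss := hs.mul_self
  have hgg := hg.mul_self
  have hsq : (s + g) * (s + g) = (2 : ℂ) • 1 := by
    rw [add_mul, mul_add, mul_add, hss, hgg, h, two_smul]
    abel
  have htwo : ∀ M : Op V, (1 / 2 : ℂ) • ((2 : ℂ) • M) = M := fun M => by
    rw [smul_smul]; norm_num
  refine ⟨Matrix.mem_unitaryGroup_iff.2 ?_, fun M hM => ?_⟩
  · have := swapUnitary_conj hs hg 1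
    rw [mul_one, mul_one, hsq, htwo] at this
    exact this
  · rw [swapUnitary_conj hs hg]
    rcases hM.comm_or_anticomm hs.inPauliGroup with h1 | h1 <;>
    rcases hM.comm_or_anticomm hg.inPauliGroup with h2 | h2
    · have : (s + g) * M * (s + g) = (2 : ℂ) • M := by
        rw [add_mul, ← h1, ← h2, ← mul_add, mul_assoc, hsq, mul_smul_comm, mul_one]
      rw [this, htwo]
      exact hM
    · have : (s + g) * M * (s + g) = (2 : ℂ) • (M * (s * g)) := by
        have h3 : g * M = -(M * g) := by rw [h2, neg_neg]
        rw [add_mul, ← h1, h3, ← mul_neg, ← mul_add, mul_assoc, ← mul_smul_comm]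
        congr 1
        rw [add_mul, mul_add, mul_add, hss, neg_mul, neg_mul, hgg, two_smul,
          show g * s = -(s * g) by rw [h, neg_neg]]
        abel
      rw [this, htwo]
      exact hM.mul (hs.inPauliGroup.mul hg.inPauliGroup)
    · have : (s + g) * M * (s + g) = (2 : ℂ) • (M * (g * s)) := by
        have h3 : s * M = -(M * s) := by rw [h1, neg_neg]
        rw [add_mul, ← h2, h3, ← mul_neg, ← mul_add, mul_assoc, ← mul_smul_comm]
        congr 1
        rw [add_mul, mul_add, mul_add, hgg, neg_mul, neg_mul, hss, two_smul, h]
        abel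
      rw [this, htwo]
      exact hM.mul (hg.inPauliGroup.mul hs.inPauliGroup)
    · have : (s + g) * M * (s + g) = (2 : ℂ) • (-M) := by
        have h3 : s * M = -(M * s) := by rw [h1, neg_neg]
        have h4 : g * M = -(M * g) := by rw [h2, neg_neg]
        rw [add_mul, h3, h4, ← neg_add, ← mul_add, neg_mul, mul_assoc, hsq, mul_smul_comm,
          mul_one, smul_neg]
      rw [this, htwo]
      exact hM.neg

theorem swapUnitary_mul_right {s g : Op V} (hs : s * s = 1) (hg : g * g = 1) :
    swapUnitary s g * g = s * swapUnitary s g := by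
  simp only [swapUnitary, smul_mul_assoc, mul_smul_comm, add_mul, mul_add, hs, hg]
  rw [add_comm]

/-- On vectors stabilized by `g`, projecting onto the `+1` outcome of an observable `s` that
anticommutes with `g` acts, up to a factor, as a Clifford unitary. -/
theorem plusProj_mul_of_stabilized {d : Type*} (s g : Op V)
    {W : Matrix (V → Fin 2) d ℂ} (hW : g * W = W) :
    plusProj s * W = (((Real.sqrt 2)⁻¹ : ℝ) : ℂ) • (swapUnitary s g * W) := by
  rw [swapUnitary, plusProj, Matrix.smul_mul, Matrix.smul_mul, smul_smul, inv_sqrt_two_mul_self,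
    Matrix.add_mul, Matrix.add_mul, hW, Matrix.one_mul, add_comm]

end PauliGroup

/-! ### Embeddings of computational bases -/

section BasisMap

/-- The operator `|x⟩ ↦ |f x⟩` defined by a map `f` between computational bases. -/
def basisMap {d e : Type} [DecidableEq e] (f : d → e) : Matrix e d ℂ :=
  (1 : Matrix e e ℂ).submatrix id f

variable {d e : Type} [DecidableEq e]

theorem basisMap_apply (f : d → e) (a : e) (x : d) :
    basisMap f a x = if a = f x then 1 else 0 := rfl

theorem conjTranspose_basisMap_mul_self [Fintype e] [DecidableEq d] {f : d → e}
    (hf : Function.Injective f) : (basisMap f)ᴴ * basisMap f = 1 := by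
  rw [basisMap, Matrix.conjTranspose_submatrix, Matrix.conjTranspose_one,
    ← Matrix.submatrix_mul _ _ f id f Function.bijective_id, one_mul, Matrix.submatrix_one f hf]

theorem mul_basisMap {l : Type} [Fintype e] (M : Matrix l e ℂ) (f : d → e) :
    M * basisMap f = M.submatrix id f := by
  rw [basisMap]
  conv_lhs => rw [← Matrix.submatrix_id_id M]
  rw [← Matrix.submatrix_mul _ _ id id f Function.bijective_id, Matrix.mul_one]

theorem conjTranspose_basisMap_mul {l : Type} [Fintype e] (M : Matrix e l ℂ) (f : d → e) :
    (basisMap f)ᴴ * M = M.submatrix f id := by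
  rw [basisMap, Matrix.conjTranspose_submatrix, Matrix.conjTranspose_one]
  conv_lhs => rw [← Matrix.submatrix_id_id M]
  rw [← Matrix.submatrix_mul _ _ f id id Function.bijective_id, Matrix.one_mul]

theorem basisMap_mul_conjTranspose_self [Fintype d] {f : d → e}
    (hf : Function.Injective f) {P : e → Prop} [DecidablePred P] (hP : ∀ a, P a ↔ ∃ x, a = f x) :
    basisMap f * (basisMap f)ᴴ = Matrix.diagonal fun a => if P a then 1 else 0 := by
  classical
  ext a b
  simp only [Matrix.mul_apply, Matrix.conjTranspose_apply, basisMap_apply, Matrix.diagonal_apply]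
  by_cases ha : P a
  · obtain ⟨x, rfl⟩ := (hP a).1 ha
    simp only [hf.eq_iff, ha, if_true, ite_mul, one_mul, zero_mul, Finset.sum_ite_eq,
      Finset.mem_univ]
    by_cases h : f x = b
    · simp [h]
    · simp [h, Ne.symm h]
  · rw [Finset.sum_eq_zero, if_neg ha, ite_self]
    intro x _
    rw [if_neg fun h => ha ((hP a).2 ⟨x, h⟩), zero_mul]

end BasisMap

section Registers

variable {V : Type} [Fintype V] [DecidableEq V]

/-! ### The operators X and Z on one qubit of a register -/

/-- The Pauli operator `Z` on the qubit `v`. -/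
def pauliZ (v : V) : Op V := pauliString (Pi.single v 3)

/-- The Pauli operator `X` on the qubit `v`. -/
def pauliX (v : V) : Op V := pauliString (Pi.single v 1)

theorem isPauliObservable_pauliZ (v : V) : IsPauliObservable (pauliZ v) := ⟨_, Or.inl rfl⟩

theorem isPauliObservable_pauliX (v : V) : IsPauliObservable (pauliX v) := ⟨_, Or.inl rfl⟩

theorem pauliZ_eq_diagonal (v : V) :
    pauliZ v = Matrix.diagonal fun a => if a v = 0 then 1 else -1 := by
  have h : ∀ (w : V) (x y : Fin 2), pauli ((Pi.single v 3 : V → Fin 4) w) x y =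
      if x = y then (if w = v then (if x = 0 then 1 else -1) else 1) else 0 := by
    intro w x y
    by_cases hw : w = v
    · subst hw
      fin_cases x <;> fin_cases y <;> simp [pauli]
    · simp [hw, pauli, Matrix.one_apply]
  ext a b
  simp only [pauliZ, pauliString, Matrix.of_apply, h, Finset.prod_ite_zero, Finset.prod_ite_eq',
    Finset.mem_univ, true_imp_iff, Matrix.diagonal_apply, funext_iff, if_true]

theorem pauliString_mul_pauliZ (p : V → Fin 4) (v : V) :
    pauliString p * pauliZ v =
      (if p v = 1 ∨ p v = 2 then (-1 : ℂ) else 1) • (pauliZ v * pauliString p) := by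
  have h : ∀ i : Fin 4, pauli i * pauli 3 =
      (if i = 1 ∨ i = 2 then (-1 : ℂ) else 1) • (pauli 3 * pauli i) := by
    intro i
    fin_cases i <;> ext x y <;> fin_cases x <;> fin_cases y <;>
      simp [pauli, Matrix.mul_apply, Fin.sum_univ_two]
  have h' : ∀ w, pauli (p w) * pauli ((Pi.single v 3 : V → Fin 4) w) =
      (if w = v then (if p v = 1 ∨ p v = 2 then (-1 : ℂ) else 1) else 1) •
        (pauli ((Pi.single v 3 : V → Fin 4) w) * pauli (p w)) := by
    intro w
    by_cases hw : w = v
    · subst hw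
      simpa using h (p w)
    · simp [hw, pauli]
  rw [pauliZ, pauliString_eq, pauliString_eq, tensorAll_mul, tensorAll_mul]
  simp only [h', tensorAll_smul, Finset.prod_ite_eq', Finset.mem_univ, if_true]

theorem pauliX_mul_pauliZ_self (v : V) : pauliX v * pauliZ v = -(pauliZ v * pauliX v) := by
  simp [pauliX, pauliString_mul_pauliZ]

theorem commute_pauliX_pauliZ {v w : V} (h : w ≠ v) : Commute (pauliX v) (pauliZ w) := by
  simp [Commute, SemiconjBy, pauliX, pauliString_mul_pauliZ, h]

theorem commute_pauliZ (v w : V) : Commute (pauliZ v) (pauliZ w) := by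
  have : ¬ ((Pi.single v 3 : V → Fin 4) w = 1 ∨ (Pi.single v 3 : V → Fin 4) w = 2) := by
    by_cases h : w = v
    · subst h; simp
    · simp [h]
  rw [Commute, SemiconjBy]
  conv_lhs => rw [pauliZ, pauliString_mul_pauliZ, if_neg this, one_smul]
  rfl

theorem plusProj_pauliZ (v : V) :
    plusProj (pauliZ v) = Matrix.diagonal fun a => if a v = 0 then 1 else 0 := by
  ext a b
  simp only [plusProj, pauliZ_eq_diagonal, Matrix.smul_apply, Matrix.add_apply, Matrix.one_apply,
    Matrix.diagonal_apply, smul_eq_mul]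
  split_ifs <;> norm_num

theorem prod_plusProj_pauliZ (l : List V) :
    (l.map fun v => plusProj (pauliZ v)).prod =
      Matrix.diagonal fun a => if ∀ v ∈ l, a v = 0 then 1 else 0 := by
  induction l with
  | nil => simp
  | cons v l ih =>
    rw [List.map_cons, List.prod_cons, ih, plusProj_pauliZ, Matrix.diagonal_mul_diagonal]
    congr 1
    ext a
    simp only [List.forall_mem_cons, ite_and, ite_mul, one_mul, zero_mul]

/-! ### The embedding of one qubit into a register -/

theorem single_injective {V : Type} [DecidableEq V] (q : V) :
    Function.Injective fun x : Fin 2 => (Pi.single q x : V → Fin 2) := by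
  intro x y h
  simpa using congrFun h q

theorem eq_single_iff {V : Type} [DecidableEq V] {q : V} {a : V → Fin 2} :
    (∃ x, a = Pi.single q x) ↔ ∀ v, v ≠ q → a v = 0 := by
  constructor
  · rintro ⟨x, rfl⟩ v hv
    simp [hv]
  · intro h
    refine ⟨a q, funext fun v => ?_⟩
    by_cases hv : v = q
    · subst hv; simp
    · simp [hv, h v hv]

/-- The isometry `|x⟩ ↦ |x⟩|0…0⟩` with `|x⟩` on the qubit `q`. -/
def embedQubit (q : V) : Matrix (V → Fin 2) (Fin 2) ℂ :=
  basisMap fun x => (Pi.single q x : V → Fin 2)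

theorem conjTranspose_embedQubit_mul_self (q : V) : (embedQubit q)ᴴ * embedQubit q = 1 :=
  conjTranspose_basisMap_mul_self (single_injective q)

theorem embedQubit_mul_conjTranspose_self (q : V) :
    embedQubit q * (embedQubit q)ᴴ =
      Matrix.diagonal fun a => if ∀ v, v ≠ q → a v = 0 then 1 else 0 :=
  basisMap_mul_conjTranspose_self (single_injective q) fun _ => eq_single_iff.symm

theorem pauliZ_mul_basisMap {d : Type} {f : d → V → Fin 2} {v : V} (h : ∀ x, f x v = 0) :
    pauliZ v * basisMap f = basisMap f := by
  ext a x
  rw [pauliZ_eq_diagonal, Matrix.diagonal_mul, basisMap_apply]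
  by_cases ha : a = f x
  · simp [ha, h x]
  · simp [ha]

theorem pauliZ_mul_embedQubit {q v : V} (h : v ≠ q) :
    pauliZ v * embedQubit q = embedQubit q :=
  pauliZ_mul_basisMap fun x => by simp [h]

/-- A Pauli string made of `1` and `Z` away from `q` acts only on the qubit `q` of `|x⟩|0…0⟩`. -/
theorem pauliString_mul_embedQubit {q : V} {p : V → Fin 4}
    (hp : ∀ v, v ≠ q → ¬ (p v = 1 ∨ p v = 2)) :
    pauliString p * embedQubit q = embedQubit q * pauli (p q) := by
  have h : ∀ (i : Fin 4) (x : Fin 2), ¬ (i = 1 ∨ i = 2) →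
      pauli i x 0 = if x = 0 then 1 else 0 := by
    intro i x hi
    fin_cases i <;> fin_cases x <;> simp_all [pauli]
  ext a x
  rw [embedQubit, mul_basisMap, Matrix.submatrix_apply, id, Matrix.mul_apply, pauliString,
    Matrix.of_apply, ← Finset.mul_prod_erase _ _ (Finset.mem_univ q), Pi.single_eq_same]
  rw [Finset.prod_congr rfl fun v hv => by
    rw [Pi.single_eq_of_ne (Finset.ne_of_mem_erase hv),
      h _ _ (hp v (Finset.ne_of_mem_erase hv))], Finset.prod_ite_zero, Finset.prod_const_one]
  simp only [basisMap_apply, ite_mul, one_mul, zero_mul]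
  by_cases ha : ∀ v, v ≠ q → a v = 0
  · obtain ⟨y, rfl⟩ := eq_single_iff.2 ha
    simp only [(single_injective q).eq_iff, Finset.sum_ite_eq,
      Finset.mem_univ, if_true, Pi.single_eq_same, Finset.mem_erase, and_true, ne_eq]
    rw [if_pos fun v hv => ha v hv, mul_one]
  · rw [if_neg (by simpa using ha), mul_zero, Finset.sum_eq_zero]
    intro y _
    exact if_neg fun hy => ha (eq_single_iff.1 ⟨y, hy⟩)

/-- The product of the operators `X` over the qubits where `c` is `1`. -/
def bitFlip (c : V → Fin 2) : Op V := pauliString fun v => if c v = 0 then 0 else 1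

theorem bitFlip_mul_basisMap {d : Type} (c : V → Fin 2) (f : d → V → Fin 2) :
    bitFlip c * basisMap f = basisMap fun x => c + f x := by
  have h : ∀ (c a b : Fin 2), pauli (if c = 0 then 0 else 1) a b = if a = c + b then 1 else 0 := by
    intro c a b
    fin_cases c <;> fin_cases a <;> fin_cases b <;> simp [pauli]
  ext a x
  rw [mul_basisMap, basisMap_apply]
  simp only [bitFlip, pauliString, Matrix.submatrix_apply, Matrix.of_apply, h, id,
    Finset.prod_ite_zero, Finset.prod_const_one, Finset.mem_univ, true_imp_iff, funext_iff,
    Pi.add_apply]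

/-- The partial trace over the qubits other than `q` as a sum over their basis states `c`, each of
which is reached from `|0…0⟩` by bit flips. -/
theorem traceExcept_eq_sum (q : V) (M : Op V) :
    traceExcept q M = ∑ c : ({v : V // v ≠ q} → Fin 2),
      (bitFlip ((Equiv.funSplitAt q (Fin 2)).symm (0, c)) * embedQubit q)ᴴ * M *
        (bitFlip ((Equiv.funSplitAt q (Fin 2)).symm (0, c)) * embedQubit q) := by
  ext x y
  rw [traceExcept, Matrix.of_apply, Matrix.sum_apply]
  refine Finset.sum_congr rfl fun c _ => ?_
  rw [embedQubit, bitFlip_mul_basisMap, mul_basisMap, conjTranspose_basisMap_mul]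
  have h : ∀ x : Fin 2, (Equiv.funSplitAt q (Fin 2)).symm (x, c) =
      (Equiv.funSplitAt q (Fin 2)).symm (0, c) + (Pi.single q x : V → Fin 2) := by
    intro x
    ext v
    by_cases hv : v = q
    · subst hv; simp
    · simp [hv]
  simp [h x, h y]

theorem trace_traceExcept (q : V) (M : Op V) : (traceExcept q M).trace = M.trace := by
  simp only [Matrix.trace, traceExcept, Matrix.diag_apply, Matrix.of_apply]
  rw [← Fintype.sum_prod_type' (f := fun x c =>
    M ((Equiv.funSplitAt q (Fin 2)).symm (x, c)) ((Equiv.funSplitAt q (Fin 2)).symm (x, c)))]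
  exact Fintype.sum_equiv (Equiv.funSplitAt q (Fin 2)).symm _ _ fun _ => rfl

end Registers

/-! ### Stabilizer maps from one qubit to a register -/

section StabilizerMaps

/-- The eigenprojectors of `X`, `Y` and `Z` project onto single-qubit stabilizer states. -/
theorem exists_stabilizerKet_of_pauli {i : Fin 4} (hi : i ≠ 0) {ε : ℂ} (hε : ε = 1 ∨ ε = -1) :
    ∃ φ : Fin 2 → ℂ, IsQubitStabilizerKet φ ∧
      (1 / 2 : ℂ) • (1 + ε • pauli i) = Matrix.vecMulVec φ (star φ) := by
  have h2 := inv_sqrt_two_mul_self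
  have hr : (starRingEnd ℂ) (((Real.sqrt 2)⁻¹ : ℝ) : ℂ) = (((Real.sqrt 2)⁻¹ : ℝ) : ℂ) :=
    Complex.conj_ofReal _
  generalize (((Real.sqrt 2)⁻¹ : ℝ) : ℂ) = r at h2 hr
  have hcε : (starRingEnd ℂ) ε = ε := by rcases hε with rfl | rfl <;> simp
  have hεε : ε * ε = 1 := by rcases hε with rfl | rfl <;> simp
  have hI := Complex.I_mul_I
  fin_cases i
  · exact absurd rfl hi
  · refine ⟨![r, ε * r], ⟨?_, 1, by decide, ε, ?_⟩, ?_⟩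
    · simp only [IsUnitKet, dotProduct, Fin.sum_univ_two, Pi.star_apply]
      simp [hr, hcε]
      linear_combination (1 + ε * ε) * h2 + (1 / 2) * hεε
    · ext x
      fin_cases x
      · simp [pauli, Matrix.mulVec, dotProduct, Fin.sum_univ_two]
      · simp [pauli, Matrix.mulVec, dotProduct, Fin.sum_univ_two]
        linear_combination -r * hεε
    · ext x y
      fin_cases x <;> fin_cases y <;> simp [pauli, Matrix.vecMulVec_apply, hr, hcε]
      · linear_combination -h2
      · linear_combination -ε * h2
      · linear_combination -ε * h2
      · linear_combination -ε * ε * h2 - (1 / 2) * hεε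
  · refine ⟨![r, ε * Complex.I * r], ⟨?_, 2, by decide, ε, ?_⟩, ?_⟩
    · simp only [IsUnitKet, dotProduct, Fin.sum_univ_two, Pi.star_apply]
      simp [hr, hcε]
      linear_combination (1 + ε * ε) * h2 + (1 / 2) * hεε - ε * ε * r * r * hI
    · ext x
      fin_cases x
      · simp [pauli, Matrix.mulVec, dotProduct, Fin.sum_univ_two]
        linear_combination -ε * r * hI
      · simp [pauli, Matrix.mulVec, dotProduct, Fin.sum_univ_two]
        linear_combination -r * Complex.I * hεε
    · ext x y
      fin_cases x <;> fin_cases y <;> simp [pauli, Matrix.vecMulVec_apply, hr, hcε]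
      · linear_combination -h2
      · linear_combination -ε * Complex.I * h2
      · linear_combination -ε * Complex.I * h2
      · linear_combination -ε * ε * h2 - (1 / 2) * hεε + ε * ε * r * r * hI
  · rcases hε with rfl | rfl
    · refine ⟨![1, 0], ⟨?_, 3, by decide, 1, ?_⟩, ?_⟩
      · simp [IsUnitKet, dotProduct, Fin.sum_univ_two]
      · ext x
        fin_cases x <;> simp [pauli, Matrix.mulVec, dotProduct, Fin.sum_univ_two]
      · ext x y
        fin_cases x <;> fin_cases y <;> norm_num [pauli, Matrix.vecMulVec_apply]
    · refine ⟨![0, 1], ⟨?_, 3, by decide, -1, ?_⟩, ?_⟩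
      · simp [IsUnitKet, dotProduct, Fin.sum_univ_two]
      · ext x
        fin_cases x <;> simp [pauli, Matrix.mulVec, dotProduct, Fin.sum_univ_two]
      · ext x y
        fin_cases x <;> fin_cases y <;> norm_num [pauli, Matrix.vecMulVec_apply]

theorem IsQubitStabilizerKet.vecMulVec_mul_self {φ : Fin 2 → ℂ} (hφ : IsQubitStabilizerKet φ) :
    Matrix.vecMulVec φ (star φ) * Matrix.vecMulVec φ (star φ) = Matrix.vecMulVec φ (star φ) := by
  rw [Matrix.vecMulVec_mul_vecMulVec, show star φ ⬝ᵥ φ = 1 from hφ.1, one_smul]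

variable {V : Type} [Fintype V] [DecidableEq V]

/-- The two kinds of maps from one qubit to the register `V` that arise as adjoints of stabilizer
operations: multiples of a Clifford unitary after the preparation of `|0…0⟩` on the qubits other
than `q`, and maps that factor through the projector onto a single-qubit stabilizer state. -/
def IsStabilizerMap (q : V) (B : Matrix (V → Fin 2) (Fin 2) ℂ) : Prop :=
  (∃ (k : ℂ) (C : Op V), IsClifford C ∧ B = k • (C * embedQubit q)) ∨
    ∃ φ : Fin 2 → ℂ, IsQubitStabilizerKet φ ∧ B * Matrix.vecMulVec φ (star φ) = B

namespace IsStabilizerMap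

variable {q : V} {B : Matrix (V → Fin 2) (Fin 2) ℂ}

theorem smul (hB : IsStabilizerMap q B) (c : ℂ) : IsStabilizerMap q (c • B) := by
  rcases hB with ⟨k, C, hC, rfl⟩ | ⟨φ, hφ, h⟩
  · exact Or.inl ⟨c * k, C, hC, by rw [smul_smul]⟩
  · exact Or.inr ⟨φ, hφ, by rw [Matrix.smul_mul, h]⟩

theorem clifford_mul (hB : IsStabilizerMap q B) {C : Op V} (hC : IsClifford C) :
    IsStabilizerMap q (C * B) := by
  rcases hB with ⟨k, D, hD, rfl⟩ | ⟨φ, hφ, h⟩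
  · exact Or.inl ⟨k, C * D, hC.mul hD, by rw [Matrix.mul_smul, Matrix.mul_assoc]⟩
  · exact Or.inr ⟨φ, hφ, by rw [Matrix.mul_assoc, h]⟩

theorem plusProj_mul_embedQubit (q : V) {s : Op V} (hs : IsPauliObservable s) :
    IsStabilizerMap q (plusProj s * embedQubit q) := by
  obtain ⟨p, ε, hε, hs'⟩ : ∃ (p : V → Fin 4) (ε : ℂ), (ε = 1 ∨ ε = -1) ∧
      s = ε • pauliString p := by
    obtain ⟨p, h | h⟩ := hs
    · exact ⟨p, 1, Or.inl rfl, by simpa using h⟩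
    · exact ⟨p, -1, Or.inr rfl, by simpa using h⟩
  by_cases hp : ∃ v, v ≠ q ∧ (p v = 1 ∨ p v = 2)
  · -- A measurement that anticommutes with the stabilizer `Z` of an ancilla is a Clifford unitary.
    obtain ⟨v, hv, hpv⟩ := hp
    refine Or.inl ⟨_, swapUnitary s (pauliZ v), isClifford_swapUnitary hs
      (isPauliObservable_pauliZ v) ?_, plusProj_mul_of_stabilized _ _ (pauliZ_mul_embedQubit hv)⟩
    rw [hs', smul_mul_assoc, pauliString_mul_pauliZ, if_pos hpv, mul_smul_comm]
    simp
  · push Not at hp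
    have h : plusProj s * embedQubit q =
        embedQubit q * ((1 / 2 : ℂ) • (1 + ε • pauli (p q))) := by
      rw [plusProj, hs', Matrix.smul_mul, Matrix.add_mul, Matrix.one_mul, Matrix.smul_mul,
        pauliString_mul_embedQubit fun v hv => by simpa using hp v hv, Matrix.mul_smul,
        Matrix.mul_add, Matrix.mul_one, Matrix.mul_smul]
    rw [h]
    by_cases h0 : p q = 0
    · refine Or.inl ⟨(1 / 2) * (1 + ε), 1, isClifford_one, ?_⟩
      rw [h0, show pauli 0 = 1 from rfl, Matrix.one_mul, mul_smul, add_smul, one_smul,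
        Matrix.mul_smul, Matrix.mul_add, Matrix.mul_smul, Matrix.mul_one]
    · obtain ⟨φ, hφ, h1⟩ := exists_stabilizerKet_of_pauli h0 hε
      refine Or.inr ⟨φ, hφ, ?_⟩
      rw [h1, Matrix.mul_assoc, hφ.vecMulVec_mul_self]

theorem plusProj_mul (hB : IsStabilizerMap q B) {s : Op V} (hs : IsPauliObservable s) :
    IsStabilizerMap q (plusProj s * B) := by
  rcases hB with ⟨k, C, hC, rfl⟩ | ⟨φ, hφ, h⟩
  · have h1 : plusProj s * C = C * plusProj (Cᴴ * s * C) := by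
      rw [plusProj, plusProj, smul_mul_assoc, mul_smul_comm, add_mul, mul_add, mul_assoc Cᴴ,
        ← mul_assoc C, hC.mul_conjTranspose, one_mul, one_mul, mul_one]
    rw [Matrix.mul_smul, ← Matrix.mul_assoc, h1, Matrix.mul_assoc]
    refine ((plusProj_mul_embedQubit q ?_).clifford_mul hC).smul k
    simpa using hC.conjTranspose.isPauliObservable_conj hs
  · exact Or.inr ⟨φ, hφ, by rw [Matrix.mul_assoc, h]⟩

theorem list_prod_mul (hB : IsStabilizerMap q B) (l : List (Op V))
    (h : ∀ s ∈ l, IsPauliObservable s) : IsStabilizerMap q ((l.map plusProj).prod * B) := by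
  induction l with
  | nil => simpa using hB
  | cons s l ih =>
    rw [List.map_cons, List.prod_cons, Matrix.mul_assoc]
    rw [List.forall_mem_cons] at h
    exact (ih h.2).plusProj_mul h.1

end IsStabilizerMap

theorem conjTranspose_plusProj {s : Op V} (hs : IsPauliObservable s) :
    (plusProj s)ᴴ = plusProj s := by
  simp [plusProj, Matrix.conjTranspose_smul, hs.conjTranspose]

/-- In the adjoint of a Kraus operator the last step acts first, each projector before the adjoint of
its Clifford unitary. -/
theorem IsStabilizerMap.conjTranspose_op_mul {q : V} {B : Matrix (V → Fin 2) (Fin 2) ℂ}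
    (hB : IsStabilizerMap q B) (K : CliffordKraus V) : IsStabilizerMap q (K.opᴴ * B) := by
  rw [CliffordKraus.op, Matrix.conjTranspose_smul, Matrix.smul_mul]
  refine IsStabilizerMap.smul ?_ _
  have h : ∀ M ∈ (List.ofFn fun x => plusProj (K.s x) * K.C x).reverse,
      ∃ x, M = plusProj (K.s x) * K.C x := by
    intro M hM
    rw [List.mem_reverse, List.mem_ofFn] at hM
    obtain ⟨x, rfl⟩ := hM
    exact ⟨x, rfl⟩
  generalize (List.ofFn fun x => plusProj (K.s x) * K.C x).reverse = l at h
  induction l generalizing B with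
  | nil => simpa using hB
  | cons M l ih =>
    rw [List.forall_mem_cons] at h
    obtain ⟨⟨x, rfl⟩, hl⟩ := h
    rw [List.prod_cons, Matrix.conjTranspose_mul, Matrix.conjTranspose_mul, Matrix.mul_assoc,
      conjTranspose_plusProj (K.isPauli x), Matrix.mul_assoc]
    exact ih ((hB.plusProj_mul (K.isPauli x)).clifford_mul (K.isClifford x).conjTranspose) hl

/-! ### Removing ancilla qubits -/

/-- If the observables `g` and `z` both stabilize `W` and anticommute with an observable `h`, then
the Clifford unitary rotating `g` via `h` to `z` fixes `W`. -/
theorem exists_clifford_of_stabilized {d : Type*} {g z h : Op V} (hg : IsPauliObservable g)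
    (hz : IsPauliObservable z) (hh : IsPauliObservable h) (hgh : h * g = -(g * h))
    (hzh : z * h = -(h * z)) {W : Matrix (V → Fin 2) d ℂ} (hgW : g * W = W) (hzW : z * W = W) :
    ∃ D : Op V, IsClifford D ∧ D * W = W ∧ D * g = z * D ∧
      ∀ M : Op V, Commute g M → Commute z M → Commute h M → Commute D M := by
  refine ⟨swapUnitary z h * swapUnitary h g, (isClifford_swapUnitary hz hh hzh).mul
    (isClifford_swapUnitary hh hg hgh), ?_, ?_, ?_⟩
  · have h1 : (z + h) * ((h + g) * W) = (2 : ℂ) • W := by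
      rw [Matrix.add_mul h g, hgW, Matrix.mul_add, Matrix.add_mul z h W, hzW, ← Matrix.mul_assoc,
        add_mul, hzh, hh.mul_self, Matrix.add_mul, Matrix.neg_mul, Matrix.mul_assoc h z, hzW,
        Matrix.one_mul, two_smul]
      abel
    rw [swapUnitary, swapUnitary, smul_mul_smul_comm, inv_sqrt_two_mul_self, Matrix.smul_mul,
      Matrix.mul_assoc, h1, smul_smul]
    norm_num
  · rw [mul_assoc, swapUnitary_mul_right hh.mul_self hg.mul_self, ← mul_assoc,
      swapUnitary_mul_right hz.mul_self hh.mul_self, mul_assoc]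
  · intro M hgM hzM hhM
    exact ((hzM.add_left hhM).smul_left _).mul_left ((hhM.add_left hgM).smul_left _)

/-- A Clifford encoding of one qubit whose range has the qubits of `T` in the state `0` can be
implemented by a Clifford unitary that commutes with `Z` on each qubit of `T`. -/
theorem IsClifford.exists_commute_pauliZ {q : V} {C : Op V} (hC : IsClifford C) (T : Finset V)
    (hq : q ∉ T) (hT : ∀ v ∈ T, pauliZ v * (C * embedQubit q) = C * embedQubit q) :
    ∃ C' : Op V, IsClifford C' ∧ C' * embedQubit q = C * embedQubit q ∧
      ∀ v ∈ T, Commute C' (pauliZ v) := by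
  induction T using Finset.induction_on with
  | empty => exact ⟨C, hC, rfl, by simp⟩
  | insert v T hv ih =>
    rw [Finset.mem_insert, not_or] at hq
    rw [Finset.forall_mem_insert] at hT
    obtain ⟨C', hC', hJ, hcomm⟩ := ih hq.2 hT.2
    have hZ := isPauliObservable_pauliZ v
    have hX := isPauliObservable_pauliX v
    have hXZ : (C' * pauliX v * C'ᴴ) * (C' * pauliZ v * C'ᴴ) =
        -((C' * pauliZ v * C'ᴴ) * (C' * pauliX v * C'ᴴ)) := by
      rw [hC'.conj_mul_conj, hC'.conj_mul_conj, pauliX_mul_pauliZ_self, mul_neg, neg_mul]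
    have hconj : ∀ {M : Op V} {w : V}, w ∈ T → Commute M (pauliZ w) →
        Commute (C' * M * C'ᴴ) (pauliZ w) := by
      intro M w hw hM
      refine ((hcomm w hw).mul_left hM).mul_left ?_
      have := congrArg Matrix.conjTranspose (hcomm w hw).eq
      rw [Matrix.conjTranspose_mul, Matrix.conjTranspose_mul,
        (isPauliObservable_pauliZ w).conjTranspose] at this
      exact this.symm
    have hne : ∀ {w : V}, w ∈ T → w ≠ v := fun hw h => hv (h ▸ hw)
    have hg := hC'.isPauliObservable_conj hZ
    have hx := hC'.isPauliObservable_conj hX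
    have hXT : ∀ {w : V}, w ∈ T → Commute (pauliX v) (pauliZ w) := fun hw =>
      commute_pauliX_pauliZ (hne hw)
    have hxT : ∀ {w : V}, w ∈ T → Commute (C' * pauliX v * C'ᴴ) (pauliZ w) := fun hw =>
      hconj hw (hXT hw)
    have hgT : ∀ {w : V}, w ∈ T → Commute (C' * pauliZ v * C'ᴴ) (pauliZ w) := fun hw =>
      hconj hw (commute_pauliZ v _)
    have hgW : C' * pauliZ v * C'ᴴ * (C' * embedQubit q) = C' * embedQubit q := by
      rw [Matrix.mul_assoc, ← Matrix.mul_assoc C'ᴴ, hC'.conjTranspose_mul, Matrix.one_mul,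
        Matrix.mul_assoc, pauliZ_mul_embedQubit (Ne.symm hq.1)]
    have hzW : pauliZ v * (C' * embedQubit q) = C' * embedQubit q := by rw [hJ, hT.1]
    -- An observable anticommuting with both stabilizers: `X`, its conjugate by the Clifford
    -- unitary, or their product.
    obtain ⟨h, hh, hgh, hzh, hhT⟩ : ∃ h : Op V, IsPauliObservable h ∧
        h * (C' * pauliZ v * C'ᴴ) = -((C' * pauliZ v * C'ᴴ) * h) ∧
        pauliZ v * h = -(h * pauliZ v) ∧ ∀ w ∈ T, Commute h (pauliZ w) := by
      have hzX : pauliZ v * pauliX v = -(pauliX v * pauliZ v) := by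
        rw [pauliX_mul_pauliZ_self, neg_neg]
      rcases hX.inPauliGroup.comm_or_anticomm hg.inPauliGroup with h1 | h1
      · rcases hZ.inPauliGroup.comm_or_anticomm hx.inPauliGroup with h2 | h2
        · obtain ⟨k, hk⟩ :=
            (hx.inPauliGroup.mul hX.inPauliGroup).exists_smul_isPauliObservable
          generalize C' * pauliZ v * C'ᴴ = g at *
          generalize C' * pauliX v * C'ᴴ = x at *
          refine ⟨_, hk, ?_, ?_, fun w hw => ((hxT hw).mul_left (hXT hw)).smul_left _⟩
          · rw [smul_mul_assoc, mul_smul_comm, ← smul_neg, mul_assoc, h1, ← mul_assoc, hXZ,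
              neg_mul, mul_assoc]
          · rw [smul_mul_assoc, mul_smul_comm, ← smul_neg, ← mul_assoc, h2, mul_assoc, hzX,
              mul_neg, mul_assoc]
        · exact ⟨_, hx, hXZ, h2, fun w hw => hxT hw⟩
      · exact ⟨_, hX, h1, hzX, fun w hw => hXT hw⟩
    obtain ⟨D, hD, hDW, hDg, hDM⟩ := exists_clifford_of_stabilized hg hZ hh hgh hzh hgW hzW
    refine ⟨D * C', hD.mul hC', by rw [Matrix.mul_assoc, hDW, hJ], ?_⟩
    rw [Finset.forall_mem_insert]
    refine ⟨?_, fun w hw => (hDM _ (hgT hw) (commute_pauliZ v w) (hhT w hw)).mul_left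
      (hcomm w hw)⟩
    rw [Commute, SemiconjBy, ← mul_assoc, ← hDg]
    simp only [mul_assoc, hC'.conjTranspose_mul, mul_one]

end StabilizerMaps

section Ancillas

theorem elim_zero_injective {V U : Type} :
    Function.Injective fun b : V → Fin 2 => (Sum.elim b 0 : V ⊕ U → Fin 2) := by
  intro a b h
  exact funext fun v => congrFun h (Sum.inl v)

theorem eq_elim_zero_iff {V U : Type} {a : V ⊕ U → Fin 2} {b : V → Fin 2} :
    a = Sum.elim b 0 ↔ a ∘ Sum.inr = 0 ∧ a ∘ Sum.inl = b := by
  constructor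
  · rintro rfl
    simp
  · rintro ⟨h, rfl⟩
    rw [← h, Sum.elim_comp_inl_inr]

variable {V U : Type} [Fintype V] [DecidableEq V] [Fintype U] [DecidableEq U]

/-- The isometry `|b⟩ ↦ |b⟩|0…0⟩` adding ancilla qubits `U` to the register `V`. -/
def addAncillas (V U : Type) [Fintype V] [DecidableEq V] [Fintype U] [DecidableEq U] :
    Matrix (V ⊕ U → Fin 2) (V → Fin 2) ℂ :=
  basisMap fun b => Sum.elim b 0

theorem conjTranspose_addAncillas_mul_self : (addAncillas V U)ᴴ * addAncillas V U = 1 :=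
  conjTranspose_basisMap_mul_self elim_zero_injective

theorem addAncillas_mul_conjTranspose_self :
    addAncillas V U * (addAncillas V U)ᴴ =
      ((Finset.univ.toList.map fun u : U => (pauliZ (Sum.inr u) : Op (V ⊕ U))).map
        plusProj).prod := by
  have h := prod_plusProj_pauliZ ((Finset.univ : Finset U).toList.map (Sum.inr : U → V ⊕ U))
  rw [List.map_map] at h ⊢
  refine Eq.trans ?_ h.symm
  have hP : ∀ a : V ⊕ U → Fin 2,
      (∀ v ∈ (Finset.univ : Finset U).toList.map (Sum.inr : U → V ⊕ U), a v = 0) ↔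
        ∃ b : V → Fin 2, a = Sum.elim b 0 := by
    intro a
    simp only [eq_elim_zero_iff, exists_and_left, exists_eq', and_true]
    simp [funext_iff]
  rw [addAncillas]
  convert basisMap_mul_conjTranspose_self elim_zero_injective hP

theorem commute_addAncillas {C : Op (V ⊕ U)} (hC : ∀ u, Commute C (pauliZ (Sum.inr u))) :
    Commute C (addAncillas V U * (addAncillas V U)ᴴ) := by
  rw [addAncillas_mul_conjTranspose_self, List.map_map]
  refine Commute.list_prod_right _ _ fun M hM => ?_
  obtain ⟨u, -, rfl⟩ := List.mem_map.1 hM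
  exact ((Commute.one_right C).add_right (hC u)).smul_right _

theorem addAncillas_mul_apply {d : Type*} (M : Matrix (V → Fin 2) d ℂ) (a : V ⊕ U → Fin 2)
    (x : d) : (addAncillas V U * M) a x =
      if a ∘ Sum.inr = 0 then M (a ∘ Sum.inl) x else 0 := by
  simp only [Matrix.mul_apply, addAncillas, basisMap_apply, eq_elim_zero_iff, ite_and, ite_mul,
    one_mul, zero_mul]
  split_ifs <;> simp

theorem addAncillas_mul_embedQubit (q : V) :
    addAncillas V U * embedQubit q = embedQubit (Sum.inl q) := by
  rw [embedQubit, mul_basisMap]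
  ext a x
  simp only [addAncillas, embedQubit, Matrix.submatrix_apply, basisMap_apply, id]
  congr 2
  ext v
  rcases v with v | u
  · by_cases hv : v = q
    · subst hv; simp
    · simp [hv]
  · simp

theorem pauliString_mul_addAncillas (p : V → Fin 4) :
    (pauliString (Sum.elim p 0) : Op (V ⊕ U)) * addAncillas V U =
      addAncillas V U * pauliString p := by
  ext a x
  rw [addAncillas_mul_apply, addAncillas, mul_basisMap]
  simp only [pauliString, Matrix.submatrix_apply, Matrix.of_apply, Fintype.prod_sum_type, id,
    Sum.elim_inl, Sum.elim_inr, Pi.zero_apply, Function.comp_apply]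
  rw [show pauli 0 = 1 from rfl]
  simp only [Matrix.one_apply, Finset.prod_ite_zero, Finset.prod_const_one, Finset.mem_univ,
    true_imp_iff, funext_iff, Function.comp_apply, Pi.zero_apply, mul_ite, mul_one, mul_zero]

/-- Restricting a Pauli operator to ancillas in the state `|0…0⟩` gives a Pauli operator, unless it
flips an ancilla. -/
theorem InPauliGroup.compress {M : Op (V ⊕ U)} (hM : InPauliGroup M) :
    (addAncillas V U)ᴴ * M * addAncillas V U = 0 ∨
      InPauliGroup ((addAncillas V U)ᴴ * M * addAncillas V U) := by
  obtain ⟨k, p, rfl⟩ := hM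
  have h : (addAncillas V U)ᴴ * pauliString p * addAncillas V U =
      (∏ u, pauli (p (Sum.inr u)) 0 0) • pauliString (p ∘ Sum.inl) := by
    rw [addAncillas, mul_basisMap, conjTranspose_basisMap_mul]
    ext a b
    simp [pauliString, mul_comm]
  rw [Matrix.mul_smul, Matrix.smul_mul, h]
  have h0 : ∀ i : Fin 4, pauli i 0 0 = 0 ∨ pauli i 0 0 = 1 := by
    intro i
    fin_cases i <;> simp [pauli]
  by_cases hu : ∃ u, pauli (p (Sum.inr u)) 0 0 = 0
  · obtain ⟨u, hu⟩ := hu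
    left
    rw [Finset.prod_eq_zero (Finset.mem_univ u) hu, zero_smul, smul_zero]
  · push Not at hu
    right
    rw [Finset.prod_eq_one fun u _ => (h0 _).resolve_left (hu u), one_smul]
    exact ⟨k, _, rfl⟩

/-- A Clifford unitary that commutes with `Z` on each ancilla preserves the ancilla state `|0…0⟩` and
acts there as a Clifford unitary of the remaining register. -/
theorem IsClifford.compress {C : Op (V ⊕ U)} (hC : IsClifford C)
    (hZ : ∀ u, Commute C (pauliZ (Sum.inr u))) :
    IsClifford ((addAncillas V U)ᴴ * C * addAncillas V U) := by
  have hE := commute_addAncillas hZ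
  have hJ := conjTranspose_addAncillas_mul_self (V := V) (U := U)
  have hlift : ∀ M : Op V, InPauliGroup M → ∃ M' : Op (V ⊕ U), InPauliGroup M' ∧
      M' * addAncillas V U = addAncillas V U * M := by
    rintro _ ⟨k, p, rfl⟩
    refine ⟨_, ⟨k, Sum.elim p 0, rfl⟩, ?_⟩
    rw [Matrix.smul_mul, Matrix.mul_smul, pauliString_mul_addAncillas]
  have hcompress : ∀ {M : Op (V ⊕ U)}, InPauliGroup M → _ := fun hM => hM.compress
  generalize addAncillas V U = J at *
  have hE' : J * (Jᴴ * Cᴴ) = Cᴴ * (J * Jᴴ) := by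
    have := congrArg Matrix.conjTranspose hE.eq
    simpa [Matrix.conjTranspose_mul, Matrix.mul_assoc] using this
  have hconj : ∀ {M : Op V} {M' : Op (V ⊕ U)}, M' * J = J * M →
      (Jᴴ * C * J) * M * (Jᴴ * C * J)ᴴ = Jᴴ * (C * M' * Cᴴ) * J := by
    intro M M' h
    calc (Jᴴ * C * J) * M * (Jᴴ * C * J)ᴴ
        = Jᴴ * C * (J * M) * (Jᴴ * Cᴴ) * J := by
          simp only [Matrix.conjTranspose_mul, Matrix.conjTranspose_conjTranspose,
            Matrix.mul_assoc]
      _ = Jᴴ * C * M' * (J * (Jᴴ * Cᴴ)) * J := by rw [← h]; simp only [Matrix.mul_assoc]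
      _ = Jᴴ * C * M' * Cᴴ * J * (Jᴴ * J) := by rw [hE']; simp only [Matrix.mul_assoc]
      _ = Jᴴ * (C * M' * Cᴴ) * J := by
          rw [hJ, Matrix.mul_one]; simp only [Matrix.mul_assoc]
  have hunit : (Jᴴ * C * J) * (Jᴴ * C * J)ᴴ = 1 := by
    have := hconj (M := 1) (M' := 1) (by rw [Matrix.one_mul, Matrix.mul_one])
    rwa [Matrix.mul_one, Matrix.mul_one, hC.mul_conjTranspose, Matrix.mul_one, hJ] at this
  refine ⟨Matrix.mem_unitaryGroup_iff.2 hunit, fun M hM => ?_⟩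
  obtain ⟨M', hM', h⟩ := hlift M hM
  rw [hconj h]
  -- The compression of a Pauli operator may vanish, but this one is conjugate to the unitary `M`.
  refine (hcompress (hC.2 M' hM')).resolve_left fun h0 => one_ne_neg_one_op (V := V) ?_
  have hunit' : (Jᴴ * C * J)ᴴ * (Jᴴ * C * J) = 1 := mul_eq_one_comm.1 hunit
  have hM0 : M = 0 := by
    rw [← hconj h] at h0
    have := congrArg (fun T => (Jᴴ * C * J)ᴴ * T * (Jᴴ * C * J)) h0
    generalize Jᴴ * C * J = D at this hunit'
    simpa only [mul_assoc, hunit', mul_one, ← mul_assoc Dᴴ D, one_mul, mul_zero, zero_mul]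
      using this
  rw [← hM.mul_conjTranspose_self, hM0, zero_mul, neg_zero]

/-- Projecting the ancillas onto `|0…0⟩` and discarding them preserves stabilizer maps. -/
theorem IsStabilizerMap.conjTranspose_addAncillas_mul {q : V}
    {B : Matrix (V ⊕ U → Fin 2) (Fin 2) ℂ} (hB : IsStabilizerMap (Sum.inl q) B) :
    IsStabilizerMap q ((addAncillas V U)ᴴ * B) := by
  have hJ := conjTranspose_addAncillas_mul_self (V := V) (U := U)
  have hZJ : ∀ u : U, (pauliZ (Sum.inr u) : Op (V ⊕ U)) * addAncillas V U = addAncillas V U :=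
    fun u => pauliZ_mul_basisMap fun x => by simp
  have h := hB.list_prod_mul (Finset.univ.toList.map fun u : U => pauliZ (Sum.inr u)) (by
    intro s hs
    obtain ⟨u, -, rfl⟩ := List.mem_map.1 hs
    exact isPauliObservable_pauliZ _)
  rw [← addAncillas_mul_conjTranspose_self] at h
  have hB' : (addAncillas V U)ᴴ * B =
      (addAncillas V U)ᴴ * (addAncillas V U * (addAncillas V U)ᴴ * B) := by
    rw [← Matrix.mul_assoc, ← Matrix.mul_assoc, hJ, Matrix.one_mul]
  rcases h with ⟨k, C, hC, h⟩ | ⟨φ, hφ, h⟩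
  · rw [hB', h]
    by_cases hk : k = 0
    · exact Or.inl ⟨0, 1, isClifford_one, by simp [hk]⟩
    · have hfix : ∀ v ∈ (Finset.univ.map ⟨Sum.inr, Sum.inr_injective⟩ : Finset (V ⊕ U)),
          pauliZ v * (C * embedQubit (Sum.inl q : V ⊕ U)) = C * embedQubit (Sum.inl q : V ⊕ U) := by
        intro v hv
        obtain ⟨u, -, rfl⟩ := Finset.mem_map.1 hv
        refine smul_right_injective _ hk ?_
        simp only [Function.Embedding.coeFn_mk]
        rw [← Matrix.mul_smul, ← h, ← Matrix.mul_assoc, ← Matrix.mul_assoc, hZJ]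
      obtain ⟨C', hC', hJC, hcomm⟩ := hC.exists_commute_pauliZ _ (by simp) hfix
      refine Or.inl ⟨k, _, hC'.compress fun u =>
        hcomm _ (Finset.mem_map_of_mem _ (Finset.mem_univ u)), ?_⟩
      rw [← hJC, Matrix.mul_smul, Matrix.mul_assoc _ _ (embedQubit q),
        addAncillas_mul_embedQubit, Matrix.mul_assoc]
  · exact Or.inr ⟨φ, hφ, by rw [hB', Matrix.mul_assoc, h]⟩

theorem opTensor_zeroProj (ρ : Op V) :
    opTensor ρ (zeroProj U) = addAncillas V U * ρ * (addAncillas V U)ᴴ := by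
  have h : addAncillas V U * ρ * (addAncillas V U)ᴴ =
      addAncillas V U * (addAncillas V U * ρᴴ)ᴴ := by
    rw [Matrix.conjTranspose_mul, Matrix.conjTranspose_conjTranspose, Matrix.mul_assoc]
  ext a b
  rw [h, addAncillas_mul_apply, Matrix.conjTranspose_apply, addAncillas_mul_apply,
    Matrix.conjTranspose_apply]
  simp only [opTensor, zeroProj, Matrix.of_apply, Matrix.single_apply, eq_comm (a := (0 : U → _))]
  split_ifs <;> simp_all

end Ancillas

/-! ### The stabilizer reduction of a Clifford unitary -/

section Reduction

variable {V : Type} [Fintype V] [DecidableEq V]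

theorem embedQubit_mul_apply {d : Type*} (q : V) (M : Matrix (Fin 2) d ℂ) (a : V → Fin 2) (x : d) :
    (embedQubit q * M) a x = if ∀ v, v ≠ q → a v = 0 then M (a q) x else 0 := by
  simp only [Matrix.mul_apply, embedQubit, basisMap_apply, ite_mul, one_mul, zero_mul]
  by_cases ha : ∀ v, v ≠ q → a v = 0
  · rw [if_pos ha]
    obtain ⟨y, rfl⟩ := eq_single_iff.2 ha
    simp only [(single_injective q).eq_iff, Finset.sum_ite_eq, Finset.mem_univ, if_true,
      Pi.single_eq_same]
  · rw [if_neg ha]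
    exact Finset.sum_eq_zero fun y _ => if_neg fun hy => ha (eq_single_iff.1 ⟨y, hy⟩)

theorem traceExcept_embedQubit (q : V) (M : Matrix (Fin 2) (Fin 2) ℂ) :
    traceExcept q (embedQubit q * M * (embedQubit q)ᴴ) = M := by
  have h : embedQubit q * M * (embedQubit q)ᴴ = embedQubit q * (embedQubit q * Mᴴ)ᴴ := by
    rw [Matrix.conjTranspose_mul, Matrix.conjTranspose_conjTranspose, Matrix.mul_assoc]
  have hc : ∀ (x : Fin 2) (c : {v : V // v ≠ q} → Fin 2),
      (∀ v, v ≠ q → (Equiv.funSplitAt q (Fin 2)).symm (x, c) v = 0) ↔ c = 0 := by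
    intro x c
    constructor
    · intro h
      ext v
      have := h v v.2
      simp [v.2] at this
      simp [this]
    · rintro rfl v hv
      simp [hv]
  ext x y
  rw [h, traceExcept, Matrix.of_apply]
  simp only [embedQubit_mul_apply, Matrix.conjTranspose_apply, hc]
  rw [Finset.sum_eq_single 0 (fun c _ hc => if_neg hc) (by simp)]
  simp

theorem embedQubit_mulVec (q : V) (α : Fin 2 → ℂ) :
    embedQubit q *ᵥ α = ketTensor q α (zeroKet _) := by
  have h : ∀ a : V → Fin 2, (∀ v, v ≠ q → a v = 0) ↔
      (fun v : {v : V // v ≠ q} => a v) = 0 := by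
    intro a
    simp [funext_iff]
  ext a
  have := embedQubit_mul_apply q (Matrix.replicateCol Unit α) a ()
  rw [← Matrix.replicateCol_mulVec, Matrix.replicateCol_apply, Matrix.replicateCol_apply] at this
  rw [this]
  simp only [ketTensor, zeroKet, Pi.single_apply, h, mul_ite, mul_one, mul_zero]

theorem IsClifford.list_prod_conj {C : Op V} (hC : IsClifford C) (l : List (Op V)) :
    (l.map fun M => C * M * Cᴴ).prod = C * l.prod * Cᴴ := by
  induction l with
  | nil => simp [hC.mul_conjTranspose]
  | cons M l ih => rw [List.map_cons, List.prod_cons, ih, List.prod_cons, hC.conj_mul_conj]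

theorem IsClifford.plusProj_conj {C : Op V} (hC : IsClifford C) (s : Op V) :
    plusProj (C * s * Cᴴ) = C * plusProj s * Cᴴ := by
  rw [plusProj, plusProj, mul_smul_comm, smul_mul_assoc, mul_add, add_mul, mul_one,
    hC.mul_conjTranspose]

theorem InPauliGroup.ne_neg_self {M : Op V} (hM : InPauliGroup M) : M ≠ -M := by
  intro h
  have h1 := hM.mul_conjTranspose_self
  have h2 : -M * Mᴴ = 1 := by rwa [← h]
  rw [neg_mul, h1] at h2
  exact one_ne_neg_one_op h2.symm

theorem InPauliGroup.not_commute {M N : Op V} (hM : InPauliGroup M) (hN : InPauliGroup N)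
    (h : M * N = -(N * M)) : ¬ Commute M N := fun hc =>
  (hN.mul hM).ne_neg_self (by rw [← h, hc.eq])

theorem isUnitKet_plusKet : IsUnitKet StabilizerCode.plusKet := by
  have := inv_sqrt_two_mul_self
  simp only [Complex.ofReal_inv] at this
  simp [IsUnitKet, StabilizerCode.plusKet, dotProduct, Fin.sum_univ_two, this]
  norm_num

theorem isUnitKet_minusKet : IsUnitKet StabilizerCode.minusKet := by
  have := inv_sqrt_two_mul_self
  simp only [Complex.ofReal_inv] at this
  simp [IsUnitKet, StabilizerCode.minusKet, dotProduct, Fin.sum_univ_two, this]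
  norm_num

theorem pauliX_mul_embedQubit (q : V) : pauliX q * embedQubit q = embedQubit q * pauli 1 := by
  rw [pauliX, pauliString_mul_embedQubit, Pi.single_eq_same]
  intro v hv
  simp [hv]

variable {n : ℕ}

/-- The resource qubits other than the first. -/
def otherQubit (i : Fin (n - 1)) : Fin n := ⟨i + 1, by omega⟩

theorem otherQubit_injective : Function.Injective (otherQubit : Fin (n - 1) → Fin n) := by
  intro i j h
  have := congrArg Fin.val h
  simp only [otherQubit, Nat.add_right_cancel_iff] at this
  exact Fin.ext this

variable [NeZero n]

theorem otherQubit_ne_zero (i : Fin (n - 1)) : (otherQubit i : Fin n) ≠ 0 := by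
  intro h
  have := congrArg Fin.val h
  simp [otherQubit] at this

theorem exists_otherQubit_eq {v : Fin n} (hv : v ≠ 0) : ∃ i, otherQubit i = v := by
  have h : v.val ≠ 0 := fun h => hv (Fin.ext (by simpa using h))
  exact ⟨⟨v.val - 1, by omega⟩, Fin.ext (by simp only [otherQubit]; omega)⟩

theorem prod_plusProj_otherQubit :
    (List.ofFn fun i => plusProj (pauliZ (otherQubit i : Fin n))).prod =
      embedQubit (0 : Fin n) * (embedQubit (0 : Fin n))ᴴ := by
  have h := prod_plusProj_pauliZ (List.ofFn (otherQubit : Fin (n - 1) → Fin n))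
  rw [List.map_ofFn] at h
  refine h.trans ?_
  rw [embedQubit_mul_conjTranspose_self]
  congr 1
  ext a
  congr 1
  simp only [List.mem_ofFn, eq_iff_iff]
  constructor
  · exact fun h v hv => h v (exists_otherQubit_eq hv)
  · rintro h _ ⟨i, rfl⟩
    exact h _ (otherQubit_ne_zero i)

/-- The range of `W` lies in the codespace if the generators fix it. -/
theorem mul_eq_self_of_mem_closure {G : Set (Op V)} {d : Type*} {W : Matrix (V → Fin 2) d ℂ}
    (hG : ∀ g ∈ G, g * W = W) {s : Op V} (hs : s ∈ Submonoid.closure G) : s * W = W := by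
  induction hs using Submonoid.closure_induction with
  | mem g hg => exact hG g hg
  | one => exact Matrix.one_mul W
  | mul x y _ _ hx hy => rw [Matrix.mul_assoc, hy, hx]

theorem commute_of_mem_closure {G : Set (Op V)} {h : Op V} (hG : ∀ g ∈ G, Commute h g) {s : Op V}
    (hs : s ∈ Submonoid.closure G) : Commute h s := by
  induction hs using Submonoid.closure_induction with
  | mem g hg => exact hG g hg
  | one => exact Commute.one_right h
  | mul x y _ _ hx hy => exact hx.mul_right hy

namespace IsClifford

theorem conjTranspose_encoding_mul_self {C : Op V} (hC : IsClifford C) (q : V) :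
    (C * embedQubit q)ᴴ * (C * embedQubit q) = 1 := by
  rw [Matrix.conjTranspose_mul, Matrix.mul_assoc, ← Matrix.mul_assoc Cᴴ, hC.conjTranspose_mul,
    Matrix.one_mul, conjTranspose_embedQubit_mul_self]

theorem conj_mul_encoding {C : Op V} (hC : IsClifford C) (M : Op V) (q : V) :
    C * M * Cᴴ * (C * embedQubit q) = C * (M * embedQubit q) := by
  rw [Matrix.mul_assoc, ← Matrix.mul_assoc Cᴴ, hC.conjTranspose_mul, Matrix.one_mul,
    Matrix.mul_assoc]

theorem commute_conj {C M N : Op V} (hC : IsClifford C) (h : Commute M N) :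
    Commute (C * M * Cᴴ) (C * N * Cᴴ) := by
  rw [Commute, SemiconjBy, hC.conj_mul_conj, hC.conj_mul_conj, h.eq]

variable {C : Op (Fin n)}

theorem conj_pauliZ_mul_encoding (hC : IsClifford C) :
    ∀ g ∈ Set.range fun i : Fin (n - 1) => C * pauliZ (otherQubit i) * Cᴴ,
      g * (C * embedQubit (0 : Fin n)) = C * embedQubit (0 : Fin n) := by
  rintro _ ⟨i, rfl⟩
  simp only [hC.conj_mul_encoding, pauliZ_mul_embedQubit (otherQubit_ne_zero i)]

/-- The stabilizer code with generators `C Z_v C†`, where `v` runs over the qubits other than the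
first. -/
def code (hC : IsClifford C) : StabilizerCode (Fin n) (n - 1) where
  gen i := C * pauliZ (otherQubit i) * Cᴴ
  inPauli i := hC.2 _ (isPauliObservable_pauliZ _).inPauliGroup
  comm i j := hC.commute_conj (commute_pauliZ _ _)
  neg_one_notMem := by
    intro h
    have h1 := mul_eq_self_of_mem_closure hC.conj_pauliZ_mul_encoding h
    have h3 : (C * embedQubit (0 : Fin n))ᴴ *
        ((-1 : Op (Fin n)) * (C * embedQubit (0 : Fin n))) = 1 := by
      rw [h1, hC.conjTranspose_encoding_mul_self]
    rw [Matrix.neg_mul, Matrix.one_mul, Matrix.mul_neg, hC.conjTranspose_encoding_mul_self] at h3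
    have := congrFun (congrFun h3 0) 0
    norm_num at this
  indep i := by
    -- `C X_v C†` commutes with all generators except the one of the qubit `v`.
    intro h
    have hX := (isPauliObservable_pauliX (otherQubit i : Fin n)).inPauliGroup
    have hZ := (isPauliObservable_pauliZ (otherQubit i : Fin n)).inPauliGroup
    refine (hC.2 _ hX).not_commute (hC.2 _ hZ) ?_ (commute_of_mem_closure ?_ h)
    · rw [hC.conj_mul_conj, hC.conj_mul_conj, pauliX_mul_pauliZ_self, mul_neg, neg_mul]
    · rintro _ ⟨j, hj, rfl⟩
      exact hC.commute_conj (commute_pauliX_pauliZ fun h => hj (otherQubit_injective h))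

theorem code_proj (hC : IsClifford C) :
    hC.code.proj = C * (embedQubit (0 : Fin n) * (embedQubit (0 : Fin n))ᴴ) * Cᴴ := by
  rw [← prod_plusProj_otherQubit, ← hC.list_prod_conj, List.map_ofFn]
  simp only [StabilizerCode.proj, code, hC.plusProj_conj]
  rfl

theorem isCodeKet (hC : IsClifford C) {α : Fin 2 → ℂ} (hα : IsUnitKet α) :
    hC.code.IsCodeKet ((C * embedQubit (0 : Fin n)) *ᵥ α) := by
  refine ⟨?_, fun s hs => ?_⟩
  · rw [IsUnitKet, Matrix.star_mulVec, Matrix.dotProduct_mulVec, Matrix.vecMul_vecMul,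
      hC.conjTranspose_encoding_mul_self, Matrix.vecMul_one]
    exact hα
  · rw [Matrix.mulVec_mulVec, mul_eq_self_of_mem_closure hC.conj_pauliZ_mul_encoding hs]

theorem isDecoding (hC : IsClifford C) : hC.code.IsDecoding 0 Cᴴ := by
  have hX : C * pauliX (0 : Fin n) * Cᴴ * (C * embedQubit (0 : Fin n)) =
      C * embedQubit (0 : Fin n) * pauli 1 := by
    rw [hC.conj_mul_encoding, pauliX_mul_embedQubit, Matrix.mul_assoc]
  have hdec : ∀ α : Fin 2 → ℂ,
      Cᴴ *ᵥ ((C * embedQubit (0 : Fin n)) *ᵥ α) = ketTensor 0 α (zeroKet {v : Fin n // v ≠ 0}) := by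
    intro α
    rw [Matrix.mulVec_mulVec, ← Matrix.mul_assoc, hC.conjTranspose_mul, Matrix.one_mul,
      embedQubit_mulVec]
  refine ⟨hC.conjTranspose, C * pauliX (0 : Fin n) * Cᴴ,
    (C * embedQubit (0 : Fin n)) *ᵥ StabilizerCode.plusKet,
    (C * embedQubit (0 : Fin n)) *ᵥ StabilizerCode.minusKet, zeroKet _, ?_,
    ⟨1, isClifford_one, (Matrix.one_mulVec _).symm⟩, hdec _, hdec _⟩
  refine ⟨hC.2 _ (isPauliObservable_pauliX _).inPauliGroup, fun s hs => ?_, fun h => ?_,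
    hC.isCodeKet isUnitKet_plusKet, hC.isCodeKet isUnitKet_minusKet, ?_, ?_⟩
  · refine commute_of_mem_closure ?_ hs
    rintro _ ⟨i, rfl⟩
    exact hC.commute_conj (commute_pauliX_pauliZ (otherQubit_ne_zero i))
  · have h1 := mul_eq_self_of_mem_closure hC.conj_pauliZ_mul_encoding h
    rw [hX] at h1
    have h2 : (C * embedQubit (0 : Fin n))ᴴ * (C * embedQubit (0 : Fin n) * pauli 1) = 1 := by
      rw [h1, hC.conjTranspose_encoding_mul_self]
    rw [← Matrix.mul_assoc, hC.conjTranspose_encoding_mul_self, Matrix.one_mul] at h2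
    have := congrFun (congrFun h2 0) 0
    simp [pauli] at this
  · rw [Matrix.mulVec_mulVec, hX, ← Matrix.mulVec_mulVec]
    congr 1
    ext x
    fin_cases x <;> simp [pauli, StabilizerCode.plusKet, Matrix.mulVec, dotProduct,
      Fin.sum_univ_two]
  · rw [Matrix.mulVec_mulVec, hX, ← Matrix.mulVec_mulVec, ← Matrix.mulVec_neg]
    congr 1
    ext x
    fin_cases x <;> simp [pauli, StabilizerCode.minusKet, Matrix.mulVec, dotProduct,
      Fin.sum_univ_two]

/-- The stabilizer reduction that undoes the Clifford unitary `C` and postselects the qubits other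
than the first on `|0…0⟩`. -/
def reduction (hC : IsClifford C) : StabilizerReduction n := ⟨hC.code, Cᴴ, hC.isDecoding⟩

theorem traceExcept_reduction_final (hC : IsClifford C) (ρ : Op (Fin n)) :
    traceExcept 0 (hC.reduction.final ρ) =
      (C * embedQubit (0 : Fin n))ᴴ * ρ * (C * embedQubit (0 : Fin n)) := by
  rw [← traceExcept_embedQubit (0 : Fin n)
    ((C * embedQubit (0 : Fin n))ᴴ * ρ * (C * embedQubit (0 : Fin n)))]
  congr 1
  have hdec : hC.reduction.decode = Cᴴ := rfl
  have hcode : hC.reduction.code = hC.code := rfl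
  rw [StabilizerReduction.final, hdec, hcode, hC.code_proj, Matrix.conjTranspose_conjTranspose]
  have h1 : ∀ M : Op (Fin n), Cᴴ * (C * M) = M := fun M => by
    rw [← Matrix.mul_assoc, hC.conjTranspose_mul, Matrix.one_mul]
  simp only [Matrix.conjTranspose_mul, Matrix.mul_assoc, h1, hC.conjTranspose_mul, Matrix.mul_one]

end IsClifford

end Reduction

/-! ### Fidelities of mixtures -/

section Fidelity

theorem fidelity_sum {ι : Type*} (s : Finset ι) (Ψ : Fin 2 → ℂ)
    (M : ι → Matrix (Fin 2) (Fin 2) ℂ) :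
    fidelity Ψ (∑ j ∈ s, M j) = ∑ j ∈ s, fidelity Ψ (M j) := by
  simp only [fidelity, Matrix.sum_mulVec, dotProduct_sum, Complex.re_sum]

theorem fidelity_ofReal_smul (Ψ : Fin 2 → ℂ) (t : ℝ) (M : Matrix (Fin 2) (Fin 2) ℂ) :
    fidelity Ψ ((t : ℂ) • M) = t * fidelity Ψ M := by
  simp only [fidelity, Matrix.smul_mulVec, dotProduct_smul, smul_eq_mul, Complex.re_ofReal_mul]

theorem fidelity_vecMulVec (Ψ φ : Fin 2 → ℂ) :
    fidelity Ψ (Matrix.vecMulVec φ (star φ)) = ‖star Ψ ⬝ᵥ φ‖ ^ 2 := by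
  have h : star φ ⬝ᵥ Ψ = star (star Ψ ⬝ᵥ φ) := by
    rw [Matrix.star_dotProduct]
  rw [fidelity, Matrix.vecMulVec_mulVec, dotProduct_smul, h, MulOpposite.smul_eq_mul_unop,
    MulOpposite.unop_op, Complex.star_def, Complex.mul_conj, Complex.ofReal_re,
    Complex.normSq_eq_norm_sq]

theorem ofReal_re_trace {M : Matrix (Fin 2) (Fin 2) ℂ} (hM : M.PosSemidef) :
    ((M.trace.re : ℝ) : ℂ) = M.trace :=
  (Complex.eq_re_of_ofReal_le (r := 0) (by simpa using hM.trace_nonneg)).symm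

theorem fidelity_normalize (Ψ : Fin 2 → ℂ) {M : Matrix (Fin 2) (Fin 2) ℂ} (hM : M.PosSemidef) :
    fidelity Ψ (M.trace⁻¹ • M) = M.trace.re⁻¹ * fidelity Ψ M := by
  rw [← fidelity_ofReal_smul, Complex.ofReal_inv, ofReal_re_trace hM]

/-- The fidelity of a mixture is an average of the fidelities of its components, so some component
does at least as well. -/
theorem exists_fidelity_le {ι : Type*} (s : Finset ι) (Ψ : Fin 2 → ℂ)
    {M : ι → Matrix (Fin 2) (Fin 2) ℂ} (hM : ∀ j ∈ s, (M j).PosSemidef)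
    (h : (∑ j ∈ s, M j).trace ≠ 0) :
    ∃ j ∈ s, (M j).trace ≠ 0 ∧ fidelity Ψ ((∑ j ∈ s, M j).trace⁻¹ • ∑ j ∈ s, M j) ≤
      fidelity Ψ ((M j).trace⁻¹ • M j) := by
  by_contra! hcon
  have hsum : (∑ j ∈ s, M j).PosSemidef := Matrix.posSemidef_sum s hM
  have ht : (∑ j ∈ s, M j).trace.re ≠ 0 := by
    rw [← ofReal_re_trace hsum] at h
    exact_mod_cast h
  set F := fidelity Ψ ((∑ j ∈ s, M j).trace⁻¹ • ∑ j ∈ s, M j) with hF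
  have hle : ∀ j ∈ s, fidelity Ψ (M j) ≤ F * (M j).trace.re ∧
      ((M j).trace ≠ 0 → fidelity Ψ (M j) < F * (M j).trace.re) := by
    intro j hj
    by_cases h0 : (M j).trace = 0
    · have : M j = 0 := (hM j hj).trace_eq_zero_iff.1 h0
      simp [this, fidelity]
    · have hlt := hcon j hj h0
      have hpos : 0 < (M j).trace.re := by
        have h1 : 0 ≤ (M j).trace := (hM j hj).trace_nonneg
        have h2 := (Complex.le_def.1 h1).1
        refine lt_of_le_of_ne h2 fun h3 => h0 ?_
        rw [← ofReal_re_trace (hM j hj), ← h3]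
        simp
      rw [fidelity_normalize Ψ (hM j hj), inv_mul_lt_iff₀ hpos, mul_comm] at hlt
      exact ⟨hlt.le, fun _ => hlt⟩
  obtain ⟨j, hj, hj0⟩ : ∃ j ∈ s, (M j).trace ≠ 0 := by
    by_contra! h0
    exact h (by rw [Matrix.trace_sum, Finset.sum_eq_zero h0])
  have hlt : ∑ j ∈ s, fidelity Ψ (M j) < ∑ j ∈ s, F * (M j).trace.re :=
    Finset.sum_lt_sum (fun j hj => (hle j hj).1) ⟨j, hj, (hle j hj).2 hj0⟩
  rw [← fidelity_sum, ← Finset.mul_sum, ← Complex.re_sum, ← Matrix.trace_sum, hF,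
    fidelity_normalize Ψ hsum, mul_comm, ← mul_assoc, mul_inv_cancel₀ ht, one_mul] at hlt
  exact lt_irrefl _ hlt

/-- If `B` factors through the projector onto `φ`, the normalized image of any state under
`ρ ↦ B† ρ B` is that projector. -/
theorem normalize_of_mul_vecMulVec {d : Type*} [Fintype d] {φ : Fin 2 → ℂ}
    (hφ : IsUnitKet φ) {B : Matrix d (Fin 2) ℂ} (hB : B * Matrix.vecMulVec φ (star φ) = B)
    (ρ : Matrix d d ℂ) (h : (Bᴴ * ρ * B).trace ≠ 0) :
    (Bᴴ * ρ * B).trace⁻¹ • (Bᴴ * ρ * B) = Matrix.vecMulVec φ (star φ) := by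
  have h1 : ∃ c : ℂ, Bᴴ * ρ * B = c • Matrix.vecMulVec φ (star φ) := by
    refine ⟨star φ ᵥ* (Bᴴ * ρ * B) ⬝ᵥ φ, ?_⟩
    have h2 : Bᴴ * ρ * B = Matrix.vecMulVec φ (star φ) * (Bᴴ * ρ * B) *
        Matrix.vecMulVec φ (star φ) := by
      have h3 : (Matrix.vecMulVec φ (star φ))ᴴ = Matrix.vecMulVec φ (star φ) := by
        rw [Matrix.conjTranspose_vecMulVec, star_star]
      conv_lhs => rw [← hB, Matrix.conjTranspose_mul, h3]
      simp only [Matrix.mul_assoc]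
    refine h2.trans ?_
    rw [Matrix.vecMulVec_mul, Matrix.vecMulVec_mul_vecMulVec, Matrix.vecMulVec_smul]
  obtain ⟨c, hc⟩ := h1
  have htr : (Matrix.vecMulVec φ (star φ)).trace = 1 := by
    rw [Matrix.trace_vecMulVec, dotProduct_comm]
    exact hφ
  rw [hc, Matrix.trace_smul, htr, smul_eq_mul, mul_one] at h ⊢
  rw [smul_smul, inv_mul_cancel₀ h, one_smul]

end Fidelity

/-! ### Decomposition of Clifford reductions -/

/-- The output of a Clifford reduction, before normalization, as a sum over the branches `i` and the
basis states `c` of the qubits traced out; each term is the adjoint of a stabilizer map. -/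
theorem CliffordReduction.traceExcept_final {n : ℕ} [NeZero n] (R : CliffordReduction n)
    (ρ : Op (Fin n)) :
    ∃ B : Fin R.r × ({v : Fin n ⊕ Fin R.m // v ≠ Sum.inl 0} → Fin 2) →
        Matrix (Fin n → Fin 2) (Fin 2) ℂ,
      (∀ j, IsStabilizerMap 0 (B j)) ∧
        traceExcept (Sum.inl 0) (R.final ρ) = ∑ j, (B j)ᴴ * ρ * B j := by
  refine ⟨fun j => (addAncillas (Fin n) (Fin R.m))ᴴ * ((R.branch j.1).opᴴ *
    (bitFlip ((Equiv.funSplitAt (Sum.inl 0) (Fin 2)).symm (0, j.2)) *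
      embedQubit (Sum.inl 0 : Fin n ⊕ Fin R.m))), fun j => ?_, ?_⟩
  · refine IsStabilizerMap.conjTranspose_addAncillas_mul
      (IsStabilizerMap.conjTranspose_op_mul ?_ _)
    exact Or.inl ⟨1, _, (inPauliGroup_pauliString _).isClifford, (one_smul _ _).symm⟩
  · rw [traceExcept_eq_sum, Fintype.sum_prod_type_right]
    refine Finset.sum_congr rfl fun c _ => ?_
    rw [CliffordReduction.final, Matrix.mul_sum, Matrix.sum_mul]
    refine Finset.sum_congr rfl fun i _ => ?_
    rw [opTensor_zeroProj]
    simp only [Matrix.conjTranspose_mul, Matrix.conjTranspose_conjTranspose, Matrix.mul_assoc]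

end CliffordRed

end

theorem theorem1 (n : ℕ) [NeZero n] (R : CliffordReduction n) (ρ : Op (Fin n)) (hρ : IsState ρ)
    (hR : R.Succeeds ρ) (Ψ : Fin 2 → ℂ) (hΨ : IsUnitKet Ψ) :
    (∃ φ : Fin 2 → ℂ, IsQubitStabilizerKet φ ∧
      fidelity Ψ (R.output ρ) ≤ ‖star Ψ ⬝ᵥ φ‖ ^ 2) ∨
    (∃ S : StabilizerReduction n, S.Succeeds ρ ∧
      fidelity Ψ (R.output ρ) ≤ fidelity Ψ (S.output ρ)) := by
  obtain ⟨B, hB, hsum⟩ := R.traceExcept_final ρ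
  have hpsd : ∀ j ∈ Finset.univ, ((B j)ᴴ * ρ * B j).PosSemidef := fun j _ =>
    hρ.1.conjTranspose_mul_mul_same (B j)
  have hR' : (∑ j, (B j)ᴴ * ρ * B j).trace ≠ 0 := by
    rw [← hsum, trace_traceExcept]
    exact hR
  obtain ⟨j, -, hj, hle⟩ := exists_fidelity_le Finset.univ Ψ hpsd hR'
  rw [← hsum, trace_traceExcept] at hle
  change fidelity Ψ (R.output ρ) ≤ _ at hle
  rcases hB j with ⟨k, C, hC, h⟩ | ⟨φ, hφ, h⟩
  · right
    have hM : (B j)ᴴ * ρ * B j = (star k * k) • traceExcept 0 (hC.reduction.final ρ) := by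
      rw [hC.traceExcept_reduction_final, h, Matrix.conjTranspose_smul, Matrix.smul_mul,
        Matrix.smul_mul, Matrix.mul_smul, smul_smul]
    rw [hM, Matrix.trace_smul, trace_traceExcept, smul_eq_mul] at hj
    refine ⟨hC.reduction, right_ne_zero_of_mul hj, hle.trans_eq ?_⟩
    rw [hM, Matrix.trace_smul, trace_traceExcept, smul_smul, smul_eq_mul, mul_inv_rev, mul_assoc,
      inv_mul_cancel₀ (left_ne_zero_of_mul hj), mul_one]
    rfl
  · left
    refine ⟨φ, hφ, hle.trans_eq ?_⟩
    rw [normalize_of_mul_vecMulVec hφ.1 h ρ hj, fidelity_vecMulVec]
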